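/- \textbf{Theorem (Congruence results).} Let $M$ and $N$ be arbitrary (well-formed) cyber-physical systems (CPSs) with $M\approx N$, where $\approx$ is weak probabilistic bisimilarity. Then: \begin{enumerate} \item $M\uplus O\approx N\uplus O$ for every CPS $O$ that is physically-disjoint from $M$ and from $N$; \item $M\parallel P\approx N\parallel P$ for every pure-logical process $P$; \item $M\backslash c\approx N\backslash c$ for every channel $c$. \end{enumerate} \textbf{Definitions.} All distributions have finite support; sub-distributions have total mass $|\gamma|\in(0,1]$; $\overline{o}$ is the Dirac distribution at $o$. \emph{Processes.} $P,Q ::= \mathsf{nil}\mid \mathsf{tick}.C\mid P\parallel Q\mid \lfloor \mathit{chn}.C\rfloor D\mid \mathit{phy}.C\mid \mathsf{if}\,(b)\,\{P\}\,\mathsf{else}\,\{Q\}\mid P\backslash c\mid X\mid \mathsf{fix}\,X.P$, where $C,D::=\bigoplus_{i\in I}p_i{:}P_i$ ($I$ finite non-empty, $p_i\in(0,1]$, $\sum_i p_i=1$), $\mathit{chn}$ is an output $\overline{c}\langle v\rangle$ or an input $c(x)$, and $\mathit{phy}$ is a sensor reading $s?(x)$ or a writing $a!v$ of a real number on an actuator.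 Values comprise the real numbers and other basic values. Processes are closed and taken up to $\alpha$-conversion, and recursion is time-guarded: in $\mathsf{fix}\,X.P$ each occurrence of $X$ in $P$ lies in the continuation $C$ of some $\mathsf{tick}.C$ or in the timeout branch $D$ of some $\lfloor \mathit{chn}.C\rfloor D$. Write $[\![\bigoplus_i p_i{:}P_i]\!]=\sum_i p_i\overline{P_i}$; operators on processes are extended to distributions in the obvious way. Transitions $P\xrightarrow{\lambda}\pi$ are generated by: \begin{itemize} \item $\lfloor\overline{c}\langle v\rangle.C\rfloor D\xrightarrow{\overline{c}v}[\![C]\!]$; $\lfloor c(x).C\rfloor D\xrightarrow{cv}[\![C\{v/x\}]\!]$ for all $v$; $a!v.C\xrightarrow{a!v}[\![C]\!]$; $s?(x).C\xrightarrow{s?x}[\![C]\!]$; \item if $P\xrightarrow{\overline{c}v}\pi_1$ and $Q\xrightarrow{cv}\pi_2$ then $P\parallel Q\xrightarrow{\tau}\pi_1\parallel\pi_2$; if $P\xrightarrow{\lambda}\pi$ and $\lambda\ne\mathsf{tick}$ then $P\parallel Q\xrightarrow{\lambda}\pi\parallel\overline{Q}$; and symmetrically; \item if $P\xrightarrow{\lambda}\pi$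 and $\lambda$ is not an input or output on $c$ then $P\backslash c\xrightarrow{\lambda}\pi\backslash c$; if $P\{\mathsf{fix}\,X.P/X\}\xrightarrow{\lambda}\pi$ then $\mathsf{fix}\,X.P\xrightarrow{\lambda}\pi$; a conditional has the transitions of the branch selected by its guard; \item $\mathsf{nil}\xrightarrow{\mathsf{tick}}\overline{\mathsf{nil}}$; $\mathsf{tick}.C\xrightarrow{\mathsf{tick}}[\![C]\!]$; $\lfloor \mathit{chn}.C\rfloor D\xrightarrow{\mathsf{tick}}[\![D]\!]$; if $P\xrightarrow{\mathsf{tick}}\pi_1$, $Q\xrightarrow{\mathsf{tick}}\pi_2$ and $P\parallel Q$ has no $\tau$-transition then $P\parallel Q\xrightarrow{\mathsf{tick}}\pi_1\parallel\pi_2$. \end{itemize} A process is \emph{pure-logical} if no sensor or actuator occurs in it. \emph{CPSs.} For sets $\mathsf X,\mathsf S,\mathsf A$ of state variables, sensors and actuators, a CPS is a triple $E;S\bowtie P$ of a physical environment $E=\langle \mathit{evol},\mathit{meas},\mathit{inv}\rangle$, with $\mathit{evol}:\mathbb R^{\mathsf X}\times\mathbb R^{\mathsf A}\to\mathcal D(\mathbb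 R^{\mathsf X})$, $\mathit{meas}:\mathbb R^{\mathsf X}\to\mathcal D(\mathbb R^{\mathsf S})$, $\mathit{inv}\subseteq\mathbb R^{\mathsf X}$; a physical state $S=\langle\xi_x,\xi_s,\xi_a\rangle\in\mathbb R^{\mathsf X}\times\mathbb R^{\mathsf S}\times\mathbb R^{\mathsf A}$; and a process $P$. It is well-formed if the sensors and actuators mentioned in $P$ belong to $\mathsf S$ and $\mathsf A$. There is one further (well-formed) CPS, $\mathsf{Dead}$, without transitions. Put $(E;\sigma\bowtie\pi)(E;S\bowtie P)=\sigma(S)\pi(P)$. The transitions $M\xrightarrow{\alpha}\gamma$ of $M=E;S\bowtie P$ are the following. If $\xi_x\in\mathit{inv}$: \begin{itemize} \item $M\xrightarrow{\alpha}E;\overline S\bowtie\pi$ if $P\xrightarrow{\alpha}\pi$ with $\alpha$ an input, an output or $\tau$; \item $M\xrightarrow{\tau}E;\overline S\bowtie\pi\{\xi_s(s)/x\}$ if $P\xrightarrow{s?x}\pi$; \item $M\xrightarrow{\tau}E;\overline{\langle\xi_x,\xi_s,\xi_a[a\mapsto v]\rangle}\bowtie\pi$ if $P\xrightarrow{a!v}\pi$;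 \item $M\xrightarrow{\mathsf{tick}}E;\mathit{next}_E(S)\bowtie\pi$ if $P\xrightarrow{\mathsf{tick}}\pi$ and $M$ has no $\tau$-transition, where $\mathit{next}_E(S)$ gives $\langle\xi_x',\xi_s',\xi_a\rangle$ probability $\mathit{evol}(\xi_x,\xi_a)(\xi_x')\cdot\mathit{meas}(\xi_x')(\xi_s')$. \end{itemize} If $\xi_x\notin\mathit{inv}$, the only transition is $M\xrightarrow{\tau}\overline{\mathsf{Dead}}$. \emph{Contexts.} $(E;S\bowtie P)\parallel Q=E;S\bowtie(P\parallel Q)$ and $(E;S\bowtie P)\backslash c=E;S\bowtie(P\backslash c)$. Two CPSs $E_i;S_i\bowtie P_i$ are physically-disjoint if their sets of state variables, of sensors and of actuators are pairwise disjoint, and then their union $\uplus$ is $(E_1\uplus E_2);(S_1\uplus S_2)\bowtie(P_1\parallel P_2)$; here $S_1\uplus S_2$ joins the functions, the maps $\mathit{evol}$ and $\mathit{meas}$ of $E_1\uplus E_2$ give the product distributions, and $\xi_x^1\uplus\xi_x^2$ satisfies the invariant iff $\xi_x^i\in\mathit{inv}^i$ for both $i$. $\mathsf{Dead}$ is physically-disjoint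 from every CPS, and $M\uplus\mathsf{Dead}=\mathsf{Dead}\uplus M=\mathsf{Dead}\parallel Q=\mathsf{Dead}\backslash c=\mathsf{Dead}$. \emph{Bisimilarity.} $M\xrightarrow{\hat\alpha}\gamma$ means $M\xrightarrow{\alpha}\gamma$, or $\alpha=\tau$ and $\gamma=\overline M$. For sub-distributions, $\gamma\xrightarrow{\hat\alpha}\gamma'$ means that $\gamma=\sum_{i\in I}p_i\overline{M_i}$ (with $I$ finite and all $p_i>0$) and there is a non-empty $J\subseteq I$ such that $M_j\xrightarrow{\hat\alpha}\gamma_j$ for $j\in J$, no $M_i$ with $i\in I\setminus J$ has an $\hat\alpha$-transition, and $\gamma'=\sum_{j\in J}p_j\gamma_j$. Let $\stackrel{\hat\tau}{\Rightarrow}$ be the reflexive-transitive closure of $\xrightarrow{\hat\tau}$ and, for $\alpha\neq\tau$, let $\stackrel{\hat\alpha}{\Rightarrow}$ be $\stackrel{\hat\tau}{\Rightarrow}\xrightarrow{\hat\alpha}\stackrel{\hat\tau}{\Rightarrow}$. A symmetric relation $\mathcal R$ on CPSs is a weak probabilistic bisimulation if $M\,\mathcal R\,N$ and $M\xrightarrow{\alpha}\gamma$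 imply that there are a distribution $\gamma'$ with $\overline N\stackrel{\hat\alpha}{\Rightarrow}\gamma'$ and a distribution $\omega$ on pairs of CPSs with marginals $\gamma$ and $\gamma'$ such that $M'\,\mathcal R\,N'$ whenever $\omega(M',N')>0$. $M\approx N$ means $M\,\mathcal R\,N$ for some weak probabilistic bisimulation $\mathcal R$. -/

import Mathlib

open scoped NNReal

universe u v w

namespace PCPS

noncomputable section

/-! ### Finite-support probability (sub-)distributions -/

/-- The total mass `∑ o, δ o` of a finitely supported non-negative weight. -/
def mass {O : Type u} (δ : O →₀ ℝ≥0) : ℝ≥0 := δ.sum fun _ p => p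

/-- Finite-support probability distributions over `O`. -/
def Dist (O : Type u) : Type u := {δ : O →₀ ℝ≥0 // mass δ = 1}

/-- Finite-support probability sub-distributions over `O`. -/
def SubDist (O : Type u) : Type u := {δ : O →₀ ℝ≥0 // 0 < mass δ ∧ mass δ ≤ 1}

/-- Weights `p_i > 0`, `∑ p_i = 1`, of a probabilistic choice with `k` branches
(so `k ≠ 0` and `p_i ∈ (0,1]`). -/
structure Weights (k : ℕ) where
  p : Fin k → ℝ≥0
  pos : ∀ i, 0 < p i
  sum_eq_one : ∑ i, p i = 1

theorem mass_add {O : Type u} (a b : O →₀ ℝ≥0) : mass (a + b) = mass a + mass b := by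
  unfold mass
  exact Finsupp.sum_add_index' (fun _ => rfl) (fun _ _ _ => rfl)

theorem mass_smul {O : Type u} (p : ℝ≥0) (a : O →₀ ℝ≥0) : mass (p • a) = p * mass a := by
  unfold mass
  rw [Finsupp.sum_smul_index (fun _ => rfl), Finsupp.sum, Finsupp.sum, Finset.mul_sum]

theorem mass_single {O : Type u} (o : O) (p : ℝ≥0) : mass (Finsupp.single o p) = p := by
  unfold mass
  exact Finsupp.sum_single_index rfl

theorem mass_finset_sum {O : Type u} {ι : Type v} (s : Finset ι) (f : ι → O →₀ ℝ≥0) :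
    mass (∑ i ∈ s, f i) = ∑ i ∈ s, mass (f i) := by
  classical
  induction s using Finset.induction_on with
  | empty => simp [mass]
  | insert a s ha ih => rw [Finset.sum_insert ha, Finset.sum_insert ha, mass_add, ih]

namespace Dist

variable {A : Type u} {B : Type v} {C : Type w}

/-- A distribution seen as a sub-distribution. -/
def toSub (δ : Dist A) : SubDist A :=
  ⟨δ.1, by rw [δ.2]; exact one_pos, le_of_eq δ.2⟩

/-- The point (Dirac) distribution. -/
def pure (a : A) : Dist A := ⟨Finsupp.single a 1, mass_single a 1⟩

/-- The convex combination `∑ a, δ a · f a`. -/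
def bind (δ : Dist A) (f : A → Dist B) : Dist B :=
  ⟨∑ a ∈ δ.1.support, δ.1 a • (f a).1, by
    rw [mass_finset_sum]
    have h : ∀ a ∈ δ.1.support, mass (δ.1 a • (f a).1) = δ.1 a := by
      intro a _
      rw [mass_smul, (f a).2, mul_one]
    rw [Finset.sum_congr rfl h]
    exact δ.2⟩

/-- The image distribution `∑ a, δ a · δ_{f a}`. -/
def map (f : A → B) (δ : Dist A) : Dist B := δ.bind fun a => pure (f a)

/-- The image `∑ a b, δ a · ε b · δ_{f a b}` of the product distribution. -/
def map₂ (f : A → B → C) (δ : Dist A) (ε : Dist B) : Dist C :=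
  δ.bind fun a => ε.map (f a)

/-- `⟦⨁ p_i : P_i⟧ = ∑ p_i · δ_{P_i}`. -/
def choice {k : ℕ} (p : Weights k) (P : Fin k → A) : Dist A :=
  ⟨∑ i, Finsupp.single (P i) (p.p i), by
    rw [mass_finset_sum, ← p.sum_eq_one]
    exact Finset.sum_congr rfl fun i _ => mass_single _ _⟩

end Dist

/-! ### Names, values, processes -/

/-- The sets of names of the calculus: state variables, channels, actuator devices, sensor devices,
and the basic values other than real numbers (Booleans, integers, names, ...). -/
structure Signature where
  StateVar : Type u
  Channel : Type u
  Actuator : Type u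
  Sensor : Type u
  Base : Type u

/-- Values: real numbers and the other basic values. -/
inductive Value (𝒩 : Signature.{u}) : Type u
  | real (r : ℝ)
  | base (b : 𝒩.Base)

/-- Assignments of values to `n` value variables. -/
abbrev Env (𝒩 : Signature.{u}) (n : ℕ) : Type u := Fin n → Value 𝒩

/-- ClosedProc terms, up to renaming of bound variables: `Proc 𝒩 n m` are the terms whose free value
variables are among `0, …, n-1` and whose free process variables are among `0, …, m-1`
(de Bruijn indices; a binder binds index `0`). Value expressions and Boolean guards
are functions of the values of the variables in scope. Each continuation is a probabilistic choice
`⨁ p_i : P_i`, given by its weights and its branches. -/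
inductive Proc (𝒩 : Signature.{u}) : ℕ → ℕ → Type u
  /-- the terminated process -/
  | nil {n m : ℕ} : Proc 𝒩 n m
  /-- `tick.C` -/
  | tick {n m k : ℕ} (p : Weights k) (C : Fin k → Proc 𝒩 n m) : Proc 𝒩 n m
  /-- `P ∥ Q` -/
  | par {n m : ℕ} (P Q : Proc 𝒩 n m) : Proc 𝒩 n m
  /-- `⌊c!e.C⌋D`, output with timeout -/
  | outp {n m k l : ℕ} (c : 𝒩.Channel) (e : Env 𝒩 n → Value 𝒩)
      (p : Weights k) (C : Fin k → Proc 𝒩 n m)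
      (q : Weights l) (D : Fin l → Proc 𝒩 n m) : Proc 𝒩 n m
  /-- `⌊c?(x).C⌋D`, input with timeout; `x` is bound in `C` -/
  | inp {n m k l : ℕ} (c : 𝒩.Channel)
      (p : Weights k) (C : Fin k → Proc 𝒩 (n + 1) m)
      (q : Weights l) (D : Fin l → Proc 𝒩 n m) : Proc 𝒩 n m
  /-- `s?(x).C`, reading of a sensor; `x` is bound in `C` -/
  | read {n m k : ℕ} (s : 𝒩.Sensor)
      (p : Weights k) (C : Fin k → Proc 𝒩 (n + 1) m) : Proc 𝒩 n m
  /-- `a!e.C`, writing of a real number on an actuator -/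
  | write {n m k : ℕ} (a : 𝒩.Actuator) (e : Env 𝒩 n → ℝ)
      (p : Weights k) (C : Fin k → Proc 𝒩 n m) : Proc 𝒩 n m
  /-- `if b then P else Q` -/
  | cond {n m : ℕ} (b : Env 𝒩 n → Bool) (P Q : Proc 𝒩 n m) : Proc 𝒩 n m
  /-- channel restriction `P \ c` -/
  | res {n m : ℕ} (P : Proc 𝒩 n m) (c : 𝒩.Channel) : Proc 𝒩 n m
  /-- a process variable -/
  | var {n m : ℕ} (X : Fin m) : Proc 𝒩 n m
  /-- recursion `fix X. P` -/
  | fix {n m : ℕ} (P : Proc 𝒩 n (m + 1)) : Proc 𝒩 n m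

namespace Proc

variable {𝒩 : Signature.{u}}

/-- The action of `g` below a value binder. -/
def liftEnv {n n' : ℕ} (g : Env 𝒩 n' → Env 𝒩 n) : Env 𝒩 (n' + 1) → Env 𝒩 (n + 1) :=
  fun ρ => Fin.cons (ρ 0) (g (Fin.tail ρ))

/-- Replaces the values of the free value variables by expressions over other value variables;
renamings and substitutions of values are instances. -/
def vmap : {n m n' : ℕ} → (Env 𝒩 n' → Env 𝒩 n) → Proc 𝒩 n m → Proc 𝒩 n' m
  | _, _, _, _, nil => nil
  | _, _, _, g, tick p C => tick p fun i => (C i).vmap g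
  | _, _, _, g, par P Q => par (P.vmap g) (Q.vmap g)
  | _, _, _, g, outp c e p C q D =>
      outp c (fun ρ => e (g ρ)) p (fun i => (C i).vmap g) q (fun i => (D i).vmap g)
  | _, _, _, g, inp c p C q D =>
      inp c p (fun i => (C i).vmap (liftEnv g)) q (fun i => (D i).vmap g)
  | _, _, _, g, read s p C => read s p fun i => (C i).vmap (liftEnv g)
  | _, _, _, g, write a e p C => write a (fun ρ => e (g ρ)) p fun i => (C i).vmap g
  | _, _, _, g, cond b P Q => cond (fun ρ => b (g ρ)) (P.vmap g) (Q.vmap g)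
  | _, _, _, g, res P c => res (P.vmap g) c
  | _, _, _, _, var X => var X
  | _, _, _, g, fix P => fix (P.vmap g)

/-- The substitution `P{v/x}` of the value `v` for the value variable `0`. -/
def vsubst {n m : ℕ} (P : Proc 𝒩 (n + 1) m) (v : Value 𝒩) : Proc 𝒩 n m :=
  P.vmap fun ρ => Fin.cons v ρ

/-- The action of a renaming of process variables below `fix`. -/
def liftRen {m m' : ℕ} (f : Fin m → Fin m') : Fin (m + 1) → Fin (m' + 1) :=
  Fin.cases 0 fun i => (f i).succ

/-- Renaming of process variables. -/
def pren : {n m m' : ℕ} → (Fin m → Fin m') → Proc 𝒩 n m → Proc 𝒩 n m'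
  | _, _, _, _, nil => nil
  | _, _, _, f, tick p C => tick p fun i => (C i).pren f
  | _, _, _, f, par P Q => par (P.pren f) (Q.pren f)
  | _, _, _, f, outp c e p C q D =>
      outp c e p (fun i => (C i).pren f) q (fun i => (D i).pren f)
  | _, _, _, f, inp c p C q D =>
      inp c p (fun i => (C i).pren f) q (fun i => (D i).pren f)
  | _, _, _, f, read s p C => read s p fun i => (C i).pren f
  | _, _, _, f, write a e p C => write a e p fun i => (C i).pren f
  | _, _, _, f, cond b P Q => cond b (P.pren f) (Q.pren f)
  | _, _, _, f, res P c => res (P.pren f) c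
  | _, _, _, f, var X => var (f X)
  | _, _, _, f, fix P => fix (P.pren (liftRen f))

/-- Below a value binder the substituted processes are weakened by the new value variable. -/
def liftV {n m m' : ℕ} (σ : Fin m → Proc 𝒩 n m') : Fin m → Proc 𝒩 (n + 1) m' :=
  fun i => (σ i).vmap Fin.tail

/-- Below `fix` the substituted processes are weakened by the new process variable. -/
def liftP {n m m' : ℕ} (σ : Fin m → Proc 𝒩 n m') : Fin (m + 1) → Proc 𝒩 n (m' + 1) :=
  Fin.cases (var 0) fun i => (σ i).pren Fin.succ

/-- Simultaneous (capture-avoiding) substitution of processes for process variables. -/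
def psubst : {n m m' : ℕ} → (Fin m → Proc 𝒩 n m') → Proc 𝒩 n m → Proc 𝒩 n m'
  | _, _, _, _, nil => nil
  | _, _, _, σ, tick p C => tick p fun i => (C i).psubst σ
  | _, _, _, σ, par P Q => par (P.psubst σ) (Q.psubst σ)
  | _, _, _, σ, outp c e p C q D =>
      outp c e p (fun i => (C i).psubst σ) q (fun i => (D i).psubst σ)
  | _, _, _, σ, inp c p C q D =>
      inp c p (fun i => (C i).psubst (liftV σ)) q (fun i => (D i).psubst σ)
  | _, _, _, σ, read s p C => read s p fun i => (C i).psubst (liftV σ)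
  | _, _, _, σ, write a e p C => write a e p fun i => (C i).psubst σ
  | _, _, _, σ, cond b P Q => cond b (P.psubst σ) (Q.psubst σ)
  | _, _, _, σ, res P c => res (P.psubst σ) c
  | _, _, _, σ, var X => σ X
  | _, _, _, σ, fix P => fix (P.psubst (liftP σ))

/-- The unfolding `P{fix X. P / X}`. -/
def unfold {n m : ℕ} (P : Proc 𝒩 n (m + 1)) : Proc 𝒩 n m :=
  P.psubst (Fin.cases (fix P) var)

/-- Every occurrence of the process variable `X` in the term is time-guarded, i.e. lies in the
continuation of a `tick` or in the timeout branch of a channel prefix. -/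
def TimeGuarded : {n m : ℕ} → Proc 𝒩 n m → Fin m → Prop
  | _, _, nil, _ => True
  | _, _, tick _ _, _ => True
  | _, _, par P Q, X => P.TimeGuarded X ∧ Q.TimeGuarded X
  | _, _, outp _ _ _ C _ _, X => ∀ i, (C i).TimeGuarded X
  | _, _, inp _ _ C _ _, X => ∀ i, (C i).TimeGuarded X
  | _, _, read _ _ C, X => ∀ i, (C i).TimeGuarded X
  | _, _, write _ _ _ C, X => ∀ i, (C i).TimeGuarded X
  | _, _, cond _ P Q, X => P.TimeGuarded X ∧ Q.TimeGuarded X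
  | _, _, res P _, X => P.TimeGuarded X
  | _, _, var Y, X => Y ≠ X
  | _, _, fix P, X => P.TimeGuarded X.succ

/-- All recursions occurring in the term are time-guarded. -/
def GuardedRec : {n m : ℕ} → Proc 𝒩 n m → Prop
  | _, _, nil => True
  | _, _, tick _ C => ∀ i, (C i).GuardedRec
  | _, _, par P Q => P.GuardedRec ∧ Q.GuardedRec
  | _, _, outp _ _ _ C _ D => (∀ i, (C i).GuardedRec) ∧ ∀ i, (D i).GuardedRec
  | _, _, inp _ _ C _ D => (∀ i, (C i).GuardedRec) ∧ ∀ i, (D i).GuardedRec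
  | _, _, read _ _ C => ∀ i, (C i).GuardedRec
  | _, _, write _ _ _ C => ∀ i, (C i).GuardedRec
  | _, _, cond _ P Q => P.GuardedRec ∧ Q.GuardedRec
  | _, _, res P _ => P.GuardedRec
  | _, _, var _ => True
  | _, _, fix P => P.TimeGuarded 0 ∧ P.GuardedRec

/-- The sensors mentioned in a term. -/
def sensors : {n m : ℕ} → Proc 𝒩 n m → Set 𝒩.Sensor
  | _, _, nil => ∅
  | _, _, tick _ C => ⋃ i, (C i).sensors
  | _, _, par P Q => P.sensors ∪ Q.sensors
  | _, _, outp _ _ _ C _ D => (⋃ i, (C i).sensors) ∪ ⋃ i, (D i).sensors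
  | _, _, inp _ _ C _ D => (⋃ i, (C i).sensors) ∪ ⋃ i, (D i).sensors
  | _, _, read s _ C => {s} ∪ ⋃ i, (C i).sensors
  | _, _, write _ _ _ C => ⋃ i, (C i).sensors
  | _, _, cond _ P Q => P.sensors ∪ Q.sensors
  | _, _, res P _ => P.sensors
  | _, _, var _ => ∅
  | _, _, fix P => P.sensors

/-- The actuators mentioned in a term. -/
def actuators : {n m : ℕ} → Proc 𝒩 n m → Set 𝒩.Actuator
  | _, _, nil => ∅
  | _, _, tick _ C => ⋃ i, (C i).actuators
  | _, _, par P Q => P.actuators ∪ Q.actuators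
  | _, _, outp _ _ _ C _ D => (⋃ i, (C i).actuators) ∪ ⋃ i, (D i).actuators
  | _, _, inp _ _ C _ D => (⋃ i, (C i).actuators) ∪ ⋃ i, (D i).actuators
  | _, _, read _ _ C => ⋃ i, (C i).actuators
  | _, _, write a _ _ C => {a} ∪ ⋃ i, (C i).actuators
  | _, _, cond _ P Q => P.actuators ∪ Q.actuators
  | _, _, res P _ => P.actuators
  | _, _, var _ => ∅
  | _, _, fix P => P.actuators

/-- A pure-logical process never acts on sensors or actuators. -/
def PureLogical {n m : ℕ} (P : Proc 𝒩 n m) : Prop := P.sensors = ∅ ∧ P.actuators = ∅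

end Proc

/-- Closed process terms. -/
abbrev ClosedProc (𝒩 : Signature.{u}) : Type u := Proc 𝒩 0 0

/-! ### Probabilistic transition system of processes -/

/-- The labels of the process transitions other than `tick`. -/
inductive Label (𝒩 : Signature.{u}) : Type u
  | tau
  | out (c : 𝒩.Channel) (v : Value 𝒩)
  | inp (c : 𝒩.Channel) (v : Value 𝒩)
  | write (a : 𝒩.Actuator) (r : ℝ)
  | read (s : 𝒩.Sensor) (v : Value 𝒩)

/-- The label is an input or an output on the channel `c`. -/
def Label.IsOn {𝒩 : Signature.{u}} (c : 𝒩.Channel) (l : Label 𝒩) : Prop :=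
  ∃ v, l = .out c v ∨ l = .inp c v

/-- The transitions of processes with labels other than `tick`. The transition of a sensor prefix is
given in the early style, as that of an input prefix: the value is instantiated when the prefix
fires. -/
inductive PStep {𝒩 : Signature.{u}} : ClosedProc 𝒩 → Label 𝒩 → Dist (ClosedProc 𝒩) → Prop
  | outp {k l : ℕ} (c : 𝒩.Channel) (e : Env 𝒩 0 → Value 𝒩)
      (p : Weights k) (C : Fin k → ClosedProc 𝒩) (q : Weights l) (D : Fin l → ClosedProc 𝒩) :
      PStep (.outp c e p C q D) (.out c (e Fin.elim0)) (Dist.choice p C)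
  | inpp {k l : ℕ} (c : 𝒩.Channel) (v : Value 𝒩)
      (p : Weights k) (C : Fin k → Proc 𝒩 1 0) (q : Weights l) (D : Fin l → ClosedProc 𝒩) :
      PStep (.inp c p C q D) (.inp c v) (Dist.choice p fun i => (C i).vsubst v)
  | write {k : ℕ} (a : 𝒩.Actuator) (e : Env 𝒩 0 → ℝ) (p : Weights k) (C : Fin k → ClosedProc 𝒩) :
      PStep (.write a e p C) (.write a (e Fin.elim0)) (Dist.choice p C)
  | read {k : ℕ} (s : 𝒩.Sensor) (v : Value 𝒩) (p : Weights k) (C : Fin k → Proc 𝒩 1 0) :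
      PStep (.read s p C) (.read s v) (Dist.choice p fun i => (C i).vsubst v)
  | comL {P Q : ClosedProc 𝒩} {c : 𝒩.Channel} {v : Value 𝒩} {π₁ π₂ : Dist (ClosedProc 𝒩)} :
      PStep P (.out c v) π₁ → PStep Q (.inp c v) π₂ →
      PStep (.par P Q) .tau (Dist.map₂ .par π₁ π₂)
  | comR {P Q : ClosedProc 𝒩} {c : 𝒩.Channel} {v : Value 𝒩} {π₁ π₂ : Dist (ClosedProc 𝒩)} :
      PStep P (.inp c v) π₁ → PStep Q (.out c v) π₂ →
      PStep (.par P Q) .tau (Dist.map₂ .par π₁ π₂)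
  | parL {P Q : ClosedProc 𝒩} {l : Label 𝒩} {π : Dist (ClosedProc 𝒩)} :
      PStep P l π → PStep (.par P Q) l (Dist.map₂ .par π (Dist.pure Q))
  | parR {P Q : ClosedProc 𝒩} {l : Label 𝒩} {π : Dist (ClosedProc 𝒩)} :
      PStep Q l π → PStep (.par P Q) l (Dist.map₂ .par (Dist.pure P) π)
  | res {P : ClosedProc 𝒩} {c : 𝒩.Channel} {l : Label 𝒩} {π : Dist (ClosedProc 𝒩)} :
      PStep P l π → ¬ l.IsOn c → PStep (.res P c) l (π.map fun P' => .res P' c)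
  | fix {P : Proc 𝒩 0 1} {l : Label 𝒩} {π : Dist (ClosedProc 𝒩)} :
      PStep P.unfold l π → PStep (.fix P) l π
  | condT {b : Env 𝒩 0 → Bool} {P Q : ClosedProc 𝒩} {l : Label 𝒩} {π : Dist (ClosedProc 𝒩)} :
      b Fin.elim0 = true → PStep P l π → PStep (.cond b P Q) l π
  | condF {b : Env 𝒩 0 → Bool} {P Q : ClosedProc 𝒩} {l : Label 𝒩} {π : Dist (ClosedProc 𝒩)} :
      b Fin.elim0 = false → PStep Q l π → PStep (.cond b P Q) l π

/-- The `tick` transitions of processes. -/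
inductive PTick {𝒩 : Signature.{u}} : ClosedProc 𝒩 → Dist (ClosedProc 𝒩) → Prop
  | nil : PTick .nil (Dist.pure .nil)
  | delay {k : ℕ} (p : Weights k) (C : Fin k → ClosedProc 𝒩) : PTick (.tick p C) (Dist.choice p C)
  | timeoutOut {k l : ℕ} (c : 𝒩.Channel) (e : Env 𝒩 0 → Value 𝒩)
      (p : Weights k) (C : Fin k → ClosedProc 𝒩) (q : Weights l) (D : Fin l → ClosedProc 𝒩) :
      PTick (.outp c e p C q D) (Dist.choice q D)
  | timeoutInp {k l : ℕ} (c : 𝒩.Channel)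
      (p : Weights k) (C : Fin k → Proc 𝒩 1 0) (q : Weights l) (D : Fin l → ClosedProc 𝒩) :
      PTick (.inp c p C q D) (Dist.choice q D)
  | par {P Q : ClosedProc 𝒩} {π₁ π₂ : Dist (ClosedProc 𝒩)} :
      PTick P π₁ → PTick Q π₂ → (¬ ∃ π, PStep (.par P Q) .tau π) →
      PTick (.par P Q) (Dist.map₂ .par π₁ π₂)
  | res {P : ClosedProc 𝒩} {c : 𝒩.Channel} {π : Dist (ClosedProc 𝒩)} :
      PTick P π → PTick (.res P c) (π.map fun P' => .res P' c)
  | fix {P : Proc 𝒩 0 1} {π : Dist (ClosedProc 𝒩)} : PTick P.unfold π → PTick (.fix P) π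
  | condT {b : Env 𝒩 0 → Bool} {P Q : ClosedProc 𝒩} {π : Dist (ClosedProc 𝒩)} :
      b Fin.elim0 = true → PTick P π → PTick (.cond b P Q) π
  | condF {b : Env 𝒩 0 → Bool} {P Q : ClosedProc 𝒩} {π : Dist (ClosedProc 𝒩)} :
      b Fin.elim0 = false → PTick Q π → PTick (.cond b P Q) π

/-! ### Cyber-physical systems -/

/-- Physical states over the state variables `X`, the sensors `S` and the actuators `A`. -/
@[ext]
structure PhysState {𝒩 : Signature.{u}}
    (X : Set 𝒩.StateVar) (S : Set 𝒩.Sensor) (A : Set 𝒩.Actuator) where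
  stateFun : X → ℝ
  sensorFun : S → ℝ
  actuatorFun : A → ℝ

/-- Physical environments over the state variables `X`, the sensors `S` and the actuators `A`. -/
structure PhysEnv {𝒩 : Signature.{u}}
    (X : Set 𝒩.StateVar) (S : Set 𝒩.Sensor) (A : Set 𝒩.Actuator) where
  evol : (X → ℝ) → (A → ℝ) → Dist (X → ℝ)
  meas : (X → ℝ) → Dist (S → ℝ)
  inv : Set (X → ℝ)

/-- Cyber-physical systems: `Dead`, and the systems `E; S ⋈ P`. -/
inductive CPS (𝒩 : Signature.{u}) : Type u
  | dead : CPS 𝒩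
  | mk {X : Set 𝒩.StateVar} {S : Set 𝒩.Sensor} {A : Set 𝒩.Actuator}
      (E : PhysEnv X S A) (st : PhysState X S A) (P : ClosedProc 𝒩) : CPS 𝒩

variable {𝒩 : Signature.{u}}

open Classical in
/-- The physical state in which the actuator `a` has been set to `r`. -/
def PhysState.setActuator {X : Set 𝒩.StateVar} {S : Set 𝒩.Sensor} {A : Set 𝒩.Actuator}
    (st : PhysState X S A) (a : A) (r : ℝ) : PhysState X S A :=
  { st with actuatorFun := Function.update st.actuatorFun a r }

/-- `next_E(S)`: the distribution of the physical state of the next time slot. -/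
def PhysEnv.next {X : Set 𝒩.StateVar} {S : Set 𝒩.Sensor} {A : Set 𝒩.Actuator}
    (E : PhysEnv X S A) (st : PhysState X S A) : Dist (PhysState X S A) :=
  (E.evol st.stateFun st.actuatorFun).bind fun x =>
    (E.meas x).map fun s => ⟨x, s, st.actuatorFun⟩

/-- The distribution `E; σ ⋈ π`, with `(E; σ ⋈ π)(E; S ⋈ P) = σ(S) · π(P)`. -/
def conf {X : Set 𝒩.StateVar} {S : Set 𝒩.Sensor} {A : Set 𝒩.Actuator}
    (E : PhysEnv X S A) (σ : Dist (PhysState X S A)) (π : Dist (ClosedProc 𝒩)) : Dist (CPS 𝒩) :=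
  Dist.map₂ (CPS.mk E) σ π

/-- The actions of cyber-physical systems. -/
inductive Action (𝒩 : Signature.{u}) : Type u
  | tau
  | tick
  | out (c : 𝒩.Channel) (v : Value 𝒩)
  | inp (c : 𝒩.Channel) (v : Value 𝒩)

/-- The `τ` transitions of cyber-physical systems. -/
inductive TauStep : CPS 𝒩 → Dist (CPS 𝒩) → Prop
  | tau {X : Set 𝒩.StateVar} {S : Set 𝒩.Sensor} {A : Set 𝒩.Actuator}
      {E : PhysEnv X S A} {st : PhysState X S A} {P : ClosedProc 𝒩} {π : Dist (ClosedProc 𝒩)} :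
      PStep P .tau π → st.stateFun ∈ E.inv →
      TauStep (.mk E st P) (conf E (Dist.pure st) π)
  | sensRead {X : Set 𝒩.StateVar} {S : Set 𝒩.Sensor} {A : Set 𝒩.Actuator}
      {E : PhysEnv X S A} {st : PhysState X S A} {P : ClosedProc 𝒩} {π : Dist (ClosedProc 𝒩)}
      (s : S) :
      PStep P (.read s (.real (st.sensorFun s))) π → st.stateFun ∈ E.inv →
      TauStep (.mk E st P) (conf E (Dist.pure st) π)
  | actWrite {X : Set 𝒩.StateVar} {S : Set 𝒩.Sensor} {A : Set 𝒩.Actuator}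
      {E : PhysEnv X S A} {st : PhysState X S A} {P : ClosedProc 𝒩} {π : Dist (ClosedProc 𝒩)}
      (a : A) (r : ℝ) :
      PStep P (.write a r) π → st.stateFun ∈ E.inv →
      TauStep (.mk E st P) (conf E (Dist.pure (st.setActuator a r)) π)
  | deadlock {X : Set 𝒩.StateVar} {S : Set 𝒩.Sensor} {A : Set 𝒩.Actuator}
      {E : PhysEnv X S A} {st : PhysState X S A} {P : ClosedProc 𝒩} :
      st.stateFun ∉ E.inv → TauStep (.mk E st P) (Dist.pure .dead)

/-- The transitions `M -α→ γ` of cyber-physical systems; `Dead` has none. -/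
inductive Step : CPS 𝒩 → Action 𝒩 → Dist (CPS 𝒩) → Prop
  | tau {M : CPS 𝒩} {γ : Dist (CPS 𝒩)} : TauStep M γ → Step M .tau γ
  | out {X : Set 𝒩.StateVar} {S : Set 𝒩.Sensor} {A : Set 𝒩.Actuator}
      {E : PhysEnv X S A} {st : PhysState X S A} {P : ClosedProc 𝒩} {π : Dist (ClosedProc 𝒩)}
      {c : 𝒩.Channel} {v : Value 𝒩} :
      PStep P (.out c v) π → st.stateFun ∈ E.inv →
      Step (.mk E st P) (.out c v) (conf E (Dist.pure st) π)
  | inp {X : Set 𝒩.StateVar} {S : Set 𝒩.Sensor} {A : Set 𝒩.Actuator}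
      {E : PhysEnv X S A} {st : PhysState X S A} {P : ClosedProc 𝒩} {π : Dist (ClosedProc 𝒩)}
      {c : 𝒩.Channel} {v : Value 𝒩} :
      PStep P (.inp c v) π → st.stateFun ∈ E.inv →
      Step (.mk E st P) (.inp c v) (conf E (Dist.pure st) π)
  | time {X : Set 𝒩.StateVar} {S : Set 𝒩.Sensor} {A : Set 𝒩.Actuator}
      {E : PhysEnv X S A} {st : PhysState X S A} {P : ClosedProc 𝒩} {π : Dist (ClosedProc 𝒩)} :
      PTick P π → (¬ ∃ γ, TauStep (.mk E st P) γ) → st.stateFun ∈ E.inv →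
      Step (.mk E st P) .tick (conf E (E.next st) π)

namespace CPS

/-- Well-formed systems: the sensors and the actuators that the process mentions belong to the
physical component, and recursion is time-guarded. -/
def WellFormed : CPS 𝒩 → Prop
  | dead => True
  | @mk _ _ S A _ _ P => P.sensors ⊆ S ∧ P.actuators ⊆ A ∧ P.GuardedRec

/-- `M ∥ Q` -/
def par : CPS 𝒩 → ClosedProc 𝒩 → CPS 𝒩
  | dead, _ => dead
  | mk E st P, Q => mk E st (.par P Q)

/-- `M \ c` -/
def res : CPS 𝒩 → 𝒩.Channel → CPS 𝒩
  | dead, _ => dead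
  | mk E st P, c => mk E st (.res P c)

end CPS

/-! ### Physically-disjoint systems and their disjoint union -/

open Classical in
/-- `ξ₁ ⊎ ξ₂` (meant for disjoint domains). -/
def union {T : Type u} {X₁ X₂ : Set T} (ξ₁ : X₁ → ℝ) (ξ₂ : X₂ → ℝ) : ↥(X₁ ∪ X₂) → ℝ :=
  fun n => if h : (n : T) ∈ X₁ then ξ₁ ⟨n, h⟩ else ξ₂ ⟨n, n.2.resolve_left h⟩

/-- The component `ξ₁` of `ξ = ξ₁ ⊎ ξ₂`. -/
def fstPart {T : Type u} {X₁ X₂ : Set T} (ξ : ↥(X₁ ∪ X₂) → ℝ) : X₁ → ℝ :=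
  fun n => ξ ⟨n, Or.inl n.2⟩

/-- The component `ξ₂` of `ξ = ξ₁ ⊎ ξ₂`. -/
def sndPart {T : Type u} {X₁ X₂ : Set T} (ξ : ↥(X₁ ∪ X₂) → ℝ) : X₂ → ℝ :=
  fun n => ξ ⟨n, Or.inr n.2⟩

/-- `S₁ ⊎ S₂` -/
def PhysState.union {X₁ X₂ : Set 𝒩.StateVar} {S₁ S₂ : Set 𝒩.Sensor} {A₁ A₂ : Set 𝒩.Actuator}
    (st₁ : PhysState X₁ S₁ A₁) (st₂ : PhysState X₂ S₂ A₂) :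
    PhysState (X₁ ∪ X₂) (S₁ ∪ S₂) (A₁ ∪ A₂) where
  stateFun := PCPS.union st₁.stateFun st₂.stateFun
  sensorFun := PCPS.union st₁.sensorFun st₂.sensorFun
  actuatorFun := PCPS.union st₁.actuatorFun st₂.actuatorFun

/-- `E₁ ⊎ E₂` -/
def PhysEnv.union {X₁ X₂ : Set 𝒩.StateVar} {S₁ S₂ : Set 𝒩.Sensor} {A₁ A₂ : Set 𝒩.Actuator}
    (E₁ : PhysEnv X₁ S₁ A₁) (E₂ : PhysEnv X₂ S₂ A₂) :
    PhysEnv (X₁ ∪ X₂) (S₁ ∪ S₂) (A₁ ∪ A₂) where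
  evol x a := Dist.map₂ PCPS.union
    (E₁.evol (fstPart x) (fstPart a)) (E₂.evol (sndPart x) (sndPart a))
  meas x := Dist.map₂ PCPS.union (E₁.meas (fstPart x)) (E₂.meas (sndPart x))
  inv := {x | fstPart x ∈ E₁.inv ∧ sndPart x ∈ E₂.inv}

namespace CPS

/-- Physically-disjoint systems; `Dead` is physically-disjoint with every system. -/
def PhysDisjoint : CPS 𝒩 → CPS 𝒩 → Prop
  | @mk _ X₁ S₁ A₁ _ _ _, @mk _ X₂ S₂ A₂ _ _ _ => Disjoint X₁ X₂ ∧ Disjoint S₁ S₂ ∧ Disjoint A₁ A₂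
  | _, _ => True

/-- `M₁ ⊎ M₂` (meant for physically-disjoint systems). -/
def union : CPS 𝒩 → CPS 𝒩 → CPS 𝒩
  | mk E₁ st₁ P₁, mk E₂ st₂ P₂ => mk (E₁.union E₂) (st₁.union st₂) (.par P₁ P₂)
  | _, _ => dead

end CPS

/-! ### Weak transitions and weak probabilistic bisimilarity -/

/-- `M -α̂→ γ`: an `α` transition or, if `α = τ`, possibly no move at all. -/
def HatStep (α : Action 𝒩) (M : CPS 𝒩) (γ : Dist (CPS 𝒩)) : Prop :=
  Step M α γ ∨ (α = .tau ∧ γ = Dist.pure M)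

/-- The lifting of `-α̂→` to sub-distributions: `γ = ∑_{i ∈ I} p_i · δ_{M_i}` moves to
`∑_{j ∈ J} p_j · γ_j`, where `J ⊆ I` is non-empty, `M_j -α̂→ γ_j` for `j ∈ J`, and no
`M_i` with `i ∉ J` has an `α̂` transition. -/
def LiftStep (α : Action 𝒩) (γ γ' : SubDist (CPS 𝒩)) : Prop :=
  ∃ (n : ℕ) (p : Fin n → ℝ≥0) (M : Fin n → CPS 𝒩) (J : Finset (Fin n))
    (δ : Fin n → Dist (CPS 𝒩)),
    (∀ i, 0 < p i) ∧ γ.1 = ∑ i, Finsupp.single (M i) (p i) ∧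
    J.Nonempty ∧ (∀ j ∈ J, HatStep α (M j) (δ j)) ∧
    (∀ i, i ∉ J → ¬ ∃ ε, HatStep α (M i) ε) ∧
    γ'.1 = ∑ j ∈ J, p j • (δ j).1

/-- The weak transition relation `=τ̂⇒`. -/
def WeakTau : SubDist (CPS 𝒩) → SubDist (CPS 𝒩) → Prop :=
  Relation.ReflTransGen (LiftStep .tau)

/-- The weak transition relation `=α̂⇒`. -/
def WeakStep (α : Action 𝒩) (γ γ' : SubDist (CPS 𝒩)) : Prop :=
  (α = .tau ∧ WeakTau γ γ') ∨
  (α ≠ .tau ∧ ∃ γ₁ γ₂, WeakTau γ γ₁ ∧ LiftStep α γ₁ γ₂ ∧ WeakTau γ₂ γ')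

/-- `ω` is a matching for `(γ, γ')`: its marginals are `γ` and `γ'`. -/
def IsMatching {O : Type u} (ω : Dist (O × O)) (γ γ' : Dist O) : Prop :=
  ω.map Prod.fst = γ ∧ ω.map Prod.snd = γ'

/-- Weak probabilistic bisimulations. -/
def IsWeakBisimulation (R : CPS 𝒩 → CPS 𝒩 → Prop) : Prop :=
  (∀ M N, R M N → R N M) ∧
  ∀ M N, R M N → ∀ α γ, Step M α γ →
    ∃ (γ' : Dist (CPS 𝒩)) (ω : Dist (CPS 𝒩 × CPS 𝒩)),
      IsMatching ω γ γ' ∧ WeakStep α (Dist.pure N).toSub γ'.toSub ∧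
      ∀ M' N', 0 < ω.1 (M', N') → R M' N'

/-- Weak probabilistic bisimilarity `M ≈ N`. -/
def Bisimilar (M N : CPS 𝒩) : Prop := ∃ R, IsWeakBisimulation R ∧ R M N

end

end PCPS

/-!
Weak probabilistic bisimilarity of cyber-physical systems is a congruence.

Two observations turn weak transitions into a convenient tool. A weak transition that ends in a full
distribution passes through full distributions only, and all the states of each intermediate
distribution take part in every step (`LiftStep.exists_lift`). Hence the transitions between
sub-distributions reduce to the lifting `Lift` of single steps along a distribution on pairs of a
state and a distribution, and bisimulations have the form of `isWeakBisimulation_iff`. Since `τ`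
steps may be idle, weak transitions are closed under convex combinations (`WTau.bind`).

Restriction on `c` just removes the steps whose action is on `c` (`step_res_iff`), so that weak
transitions pass through it. The two other operators are instances of one notion of composition
(`IsComposition`): as long as the invariants hold, the steps of a composed system are interleavings,
communications and joint ticks. The composition of related systems with the same component yields a
bisimulation (`isWeakBisimulation_closure`), for which two points need an argument.

* Invariants. Where the invariant of a system fails, its only step leads to `Dead`, and the
  component is stuck. So related systems must agree on whether the invariant holds
  (`IsWeakBisimulation.alive_iff`). This is where well-formedness enters: recursion being
  time-guarded, `Proc.rank` decreases with every step other than a tick, so that a system whose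
  invariant holds gets to a state without `τ` steps, and there it can let time pass
  (`exists_pTick`), which `Dead` cannot match.

* Time. Suppose that `M` composed with `k` ticks, and that a related `N` matches the tick of `M`
  after some `τ` steps that lead to `N'`. As `M` ticks, it has no `τ` step, hence it is related to
  `N'` itself (`IsWeakBisimulation.rel_of_wTau`) and can perform every visible action of `N'`. So `N'`
  cannot communicate with `k`, for otherwise `M` could, and the composition of `N'` with `k` ticks.
-/

namespace PCPS

noncomputable section

/-! ### The monad of finite-support distributions -/

namespace Dist

variable {A : Type u} {B : Type v} {C : Type w}

@[ext]
theorem ext {δ ε : Dist A} (h : ∀ a, δ.1 a = ε.1 a) : δ = ε :=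
  Subtype.ext (Finsupp.ext h)

/-- The support of a distribution. -/
def supp (δ : Dist A) : Set A := {a | δ.1 a ≠ 0}

theorem mem_supp {δ : Dist A} {a : A} : a ∈ δ.supp ↔ δ.1 a ≠ 0 := Iff.rfl

theorem mem_supp_iff_pos {δ : Dist A} {a : A} : a ∈ δ.supp ↔ 0 < δ.1 a :=
  pos_iff_ne_zero.symm

theorem bind_val (δ : Dist A) (f : A → Dist B) :
    (δ.bind f).1 = δ.1.sum fun a p => p • (f a).1 := rfl

theorem bind_apply (δ : Dist A) (f : A → Dist B) (b : B) :
    (δ.bind f).1 b = ∑ a ∈ δ.1.support, δ.1 a * (f a).1 b := by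
  rw [bind_val, Finsupp.sum, Finsupp.finsetSum_apply]
  rfl

theorem pure_val (a : A) : (pure a).1 = Finsupp.single a 1 := rfl

@[simp]
theorem mem_supp_pure {a b : A} : b ∈ (pure a).supp ↔ b = a := by
  classical
  rw [mem_supp, pure_val, Finsupp.single_apply]
  by_cases h : a = b <;> simp [h, eq_comm]

@[simp]
theorem mem_supp_bind {δ : Dist A} {f : A → Dist B} {b : B} :
    b ∈ (δ.bind f).supp ↔ ∃ a ∈ δ.supp, b ∈ (f a).supp := by
  rw [mem_supp, bind_apply, Ne, Finset.sum_eq_zero_iff]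
  push Not
  simp only [mem_supp, Finsupp.mem_support_iff, mul_ne_zero_iff]
  grind

theorem supp_nonempty (δ : Dist A) : δ.supp.Nonempty := by
  by_contra h
  have h0 : δ.1 = 0 := by
    ext a
    by_contra ha
    exact h ⟨a, fun h' => ha (by simp [h'])⟩
  have := δ.2
  rw [h0] at this
  simp [mass] at this

@[simp]
theorem pure_bind (a : A) (f : A → Dist B) : (pure a).bind f = f a := by
  apply Subtype.ext
  rw [bind_val, pure_val, Finsupp.sum_single_index] <;> simp

@[simp]
theorem bind_pure (δ : Dist A) : δ.bind pure = δ := by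
  apply Subtype.ext
  rw [bind_val]
  simp only [pure_val, Finsupp.smul_single, smul_eq_mul, mul_one]
  exact Finsupp.sum_single _

@[simp]
theorem bind_assoc (δ : Dist A) (f : A → Dist B) (g : B → Dist C) :
    (δ.bind f).bind g = δ.bind fun a => (f a).bind g := by
  have key (d : A →₀ ℝ≥0) (F : A → B →₀ ℝ≥0) (G : B → C →₀ ℝ≥0) :
      ((d.sum fun a p => p • F a).sum fun b q => q • G b) =
        d.sum fun a p => p • (F a).sum fun b q => q • G b := by
    refine (Finsupp.sum_sum_index (h := fun b (q : ℝ≥0) => q • G b) (fun _ => zero_smul _ _)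
      (fun _ _ _ => add_smul _ _ _)).trans (Finsupp.sum_congr fun a _ => ?_)
    rw [Finsupp.sum_smul_index (h := fun b (q : ℝ≥0) => q • G b) (fun _ => zero_smul _ _),
      Finsupp.smul_sum]
    simp only [mul_smul]
  exact Subtype.ext (key δ.1 (fun a => (f a).1) fun b => (g b).1)

theorem bind_congr {δ : Dist A} {f g : A → Dist B} (h : ∀ a ∈ δ.supp, f a = g a) :
    δ.bind f = δ.bind g := by
  apply Subtype.ext
  simp only [bind_val]
  exact Finsupp.sum_congr fun a ha => by rw [h a (Finsupp.mem_support_iff.1 ha)]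

@[simp]
theorem bind_const (δ : Dist A) (ε : Dist B) : (δ.bind fun _ => ε) = ε := by
  refine Dist.ext fun b => ?_
  have h := δ.2
  rw [mass, Finsupp.sum] at h
  rw [bind_apply, ← Finset.sum_mul, h, one_mul]

theorem bind_comm (δ : Dist A) (ε : Dist B) (f : A → B → Dist C) :
    (δ.bind fun a => ε.bind (f a)) = ε.bind fun b => δ.bind fun a => f a b := by
  refine Dist.ext fun c => ?_
  simp only [bind_apply, Finset.mul_sum]
  rw [Finset.sum_comm]
  exact Finset.sum_congr rfl fun b _ => Finset.sum_congr rfl fun a _ =>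
    mul_left_comm (δ.1 a) (ε.1 b) ((f a b).1 c)

theorem map_eq_bind (f : A → B) (δ : Dist A) : δ.map f = δ.bind fun a => pure (f a) := rfl

theorem map₂_eq_bind (f : A → B → C) (δ : Dist A) (ε : Dist B) :
    map₂ f δ ε = δ.bind fun a => ε.bind fun b => pure (f a b) := rfl

theorem bind_map (δ : Dist A) (f : A → B) (g : B → Dist C) :
    (δ.map f).bind g = δ.bind fun a => g (f a) := by simp [map_eq_bind]

@[simp]
theorem mem_supp_map {δ : Dist A} {f : A → B} {b : B} :
    b ∈ (δ.map f).supp ↔ ∃ a ∈ δ.supp, b = f a := by simp [map_eq_bind]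

@[simp]
theorem mem_supp_map₂ {f : A → B → C} {δ : Dist A} {ε : Dist B} {c : C} :
    c ∈ (map₂ f δ ε).supp ↔ ∃ a ∈ δ.supp, ∃ b ∈ ε.supp, c = f a b := by simp [map₂_eq_bind]

theorem exists_of_mem_supp_choice {k : ℕ} {p : Weights k} {P : Fin k → A} {a : A}
    (h : a ∈ (choice p P).supp) : ∃ i, a = P i := by
  classical
  by_contra hn
  push Not at hn
  apply h
  simp only [choice, Finsupp.finsetSum_apply]
  exact Finset.sum_eq_zero fun i _ => Finsupp.single_eq_of_ne (hn i)

end Dist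

/-! ### Couplings and liftings to distributions -/

/-- The distributions `γ` and `δ` are the marginals of a distribution on pairs related by `R`. -/
def Coupled {A : Type u} {B : Type v} (R : A → B → Prop) (γ : Dist A) (δ : Dist B) : Prop :=
  ∃ ω : Dist (A × B), ω.map Prod.fst = γ ∧ ω.map Prod.snd = δ ∧ ∀ x ∈ ω.supp, R x.1 x.2

namespace Coupled

variable {A : Type u} {B : Type v} {R : A → B → Prop} {γ : Dist A} {δ : Dist B}

theorem pure {a : A} {b : B} (h : R a b) : Coupled R (Dist.pure a) (Dist.pure b) :=
  ⟨Dist.pure (a, b), by simp [Dist.map_eq_bind], by simp [Dist.map_eq_bind], by simpa⟩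

theorem map {A' B' : Type*} {S : A' → B' → Prop} {f : A → A'} {g : B → B'}
    (h : Coupled R γ δ) (hfg : ∀ a ∈ γ.supp, ∀ b ∈ δ.supp, R a b → S (f a) (g b)) :
    Coupled S (γ.map f) (δ.map g) := by
  obtain ⟨ω, rfl, rfl, h⟩ := h
  refine ⟨ω.map (Prod.map f g), by simp [Dist.map_eq_bind], by simp [Dist.map_eq_bind], ?_⟩
  intro x hx
  obtain ⟨y, hy, rfl⟩ := Dist.mem_supp_map.1 hx
  exact hfg _ (Dist.mem_supp_map.2 ⟨y, hy, rfl⟩) _ (Dist.mem_supp_map.2 ⟨y, hy, rfl⟩) (h y hy)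

theorem of_forall (h : ∀ a ∈ γ.supp, ∀ b ∈ δ.supp, R a b) : Coupled R γ δ :=
  ⟨Dist.map₂ Prod.mk γ δ, by simp [Dist.map_eq_bind, Dist.map₂_eq_bind],
    by simp [Dist.map_eq_bind, Dist.map₂_eq_bind], by
      intro x hx
      obtain ⟨a, ha, b, hb, rfl⟩ := Dist.mem_supp_map₂.1 hx
      exact h a ha b hb⟩

theorem bind {C : Type w} {η : Dist C} {F : C → Dist A} {G : C → Dist B}
    (h : ∀ c ∈ η.supp, Coupled R (F c) (G c)) : Coupled R (η.bind F) (η.bind G) := by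
  classical
  have h' : ∀ c, ∃ ω : Dist (A × B), c ∈ η.supp →
      ω.map Prod.fst = F c ∧ ω.map Prod.snd = G c ∧ ∀ x ∈ ω.supp, R x.1 x.2 := by
    intro c
    by_cases hc : c ∈ η.supp
    · exact (h c hc).imp fun ω hω _ => hω
    · exact ⟨Dist.map₂ Prod.mk (F c) (G c), fun h => absurd h hc⟩
  choose ω hω using h'
  refine ⟨η.bind ω, ?_, ?_, ?_⟩
  · rw [Dist.map_eq_bind, Dist.bind_assoc]
    exact Dist.bind_congr fun c hc => (hω c hc).1
  · rw [Dist.map_eq_bind, Dist.bind_assoc]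
    exact Dist.bind_congr fun c hc => (hω c hc).2.1
  · intro x hx
    obtain ⟨c, hc, hx⟩ := Dist.mem_supp_bind.1 hx
    exact (hω c hc).2.2 x hx

theorem exists_right (h : Coupled R γ δ) {a : A} (ha : a ∈ γ.supp) : ∃ b ∈ δ.supp, R a b := by
  obtain ⟨ω, rfl, rfl, h⟩ := h
  obtain ⟨x, hx, rfl⟩ := Dist.mem_supp_map.1 ha
  exact ⟨x.2, Dist.mem_supp_map.2 ⟨x, hx, rfl⟩, h x hx⟩

end Coupled

/-- The lifting to distributions of a relation `T` between states and distributions: `γ` is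
`∑ p_i · δ_{a_i}` and `γ'` is `∑ p_i · δ_i`, where `T a_i δ_i` for all `i`. -/
def Lift {A : Type u} (T : A → Dist A → Prop) (γ γ' : Dist A) : Prop :=
  ∃ ω : Dist (A × Dist A), ω.map Prod.fst = γ ∧ ω.bind Prod.snd = γ' ∧ ∀ x ∈ ω.supp, T x.1 x.2

namespace Lift

variable {A : Type u} {T : A → Dist A → Prop}

theorem of_rel {a : A} {δ : Dist A} (h : T a δ) : Lift T (Dist.pure a) δ :=
  ⟨Dist.pure (a, δ), by simp [Dist.map_eq_bind], by simp, by simpa⟩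

theorem bind {C : Type w} {η : Dist C} {F G : C → Dist A}
    (h : ∀ c ∈ η.supp, Lift T (F c) (G c)) : Lift T (η.bind F) (η.bind G) := by
  classical
  have h' : ∀ c, ∃ ω : Dist (A × Dist A), c ∈ η.supp →
      ω.map Prod.fst = F c ∧ ω.bind Prod.snd = G c ∧ ∀ x ∈ ω.supp, T x.1 x.2 := by
    intro c
    by_cases hc : c ∈ η.supp
    · exact (h c hc).imp fun ω hω _ => hω
    · exact ⟨Dist.map₂ Prod.mk (F c) (Dist.pure (G c)), fun h => absurd h hc⟩
  choose ω hω using h'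
  refine ⟨η.bind ω, ?_, ?_, ?_⟩
  · rw [Dist.map_eq_bind, Dist.bind_assoc]
    exact Dist.bind_congr fun c hc => (hω c hc).1
  · rw [Dist.bind_assoc]
    exact Dist.bind_congr fun c hc => (hω c hc).2.1
  · intro x hx
    obtain ⟨c, hc, hx⟩ := Dist.mem_supp_bind.1 hx
    exact (hω c hc).2.2 x hx

theorem refl (h : ∀ a, T a (Dist.pure a)) (γ : Dist A) : Lift T γ γ := by
  have := bind (η := γ) (F := Dist.pure) (G := Dist.pure) fun a _ => of_rel (h a)
  simpa using this

/-- A lifted step followed on both sides by a substitution `f`, respectively `g`, of states by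
distributions is a lifted step, as soon as this is the case for each single step. -/
theorem bind_bind {B : Type v} {S : B → Dist B → Prop} {γ γ' : Dist A} {f g : A → Dist B}
    (h : Lift T γ γ') (hfg : ∀ a ∈ γ.supp, ∀ δ, T a δ → Lift S (f a) (δ.bind g)) :
    Lift S (γ.bind f) (γ'.bind g) := by
  obtain ⟨ω, rfl, rfl, h⟩ := h
  rw [Dist.bind_map, Dist.bind_assoc]
  exact bind fun x hx => hfg _ (Dist.mem_supp_map.2 ⟨x, hx, rfl⟩) _ (h x hx)

theorem exists_left {γ γ' : Dist A} (h : Lift T γ γ') {b : A} (hb : b ∈ γ'.supp) :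
    ∃ a ∈ γ.supp, ∃ δ, T a δ ∧ b ∈ δ.supp := by
  obtain ⟨ω, rfl, rfl, h⟩ := h
  obtain ⟨x, hx, hb⟩ := Dist.mem_supp_bind.1 hb
  exact ⟨x.1, Dist.mem_supp_map.2 ⟨x, hx, rfl⟩, x.2, h x hx, hb⟩

theorem exists_rel {γ γ' : Dist A} (h : Lift T γ γ') {a : A} (ha : a ∈ γ.supp) :
    ∃ δ, T a δ := by
  obtain ⟨ω, rfl, rfl, h⟩ := h
  obtain ⟨x, hx, rfl⟩ := Dist.mem_supp_map.1 ha
  exact ⟨x.2, h x hx⟩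

end Lift

/-! ### Devices of a process and its transitions -/

namespace Proc

variable {𝒩 : Signature.{u}}

theorem sensors_vmap {n m : ℕ} (P : Proc 𝒩 n m) :
    ∀ {n' : ℕ} (g : Env 𝒩 n' → Env 𝒩 n), (P.vmap g).sensors = P.sensors := by
  induction P <;> intro n' g <;> simp_all only [vmap, sensors]

theorem actuators_vmap {n m : ℕ} (P : Proc 𝒩 n m) :
    ∀ {n' : ℕ} (g : Env 𝒩 n' → Env 𝒩 n), (P.vmap g).actuators = P.actuators := by
  induction P <;> intro n' g <;> simp_all only [vmap, actuators]

theorem sensors_pren {n m : ℕ} (P : Proc 𝒩 n m) :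
    ∀ {m' : ℕ} (f : Fin m → Fin m'), (P.pren f).sensors = P.sensors := by
  induction P <;> intro m' f <;> simp_all only [pren, sensors]

theorem actuators_pren {n m : ℕ} (P : Proc 𝒩 n m) :
    ∀ {m' : ℕ} (f : Fin m → Fin m'), (P.pren f).actuators = P.actuators := by
  induction P <;> intro m' f <;> simp_all only [pren, actuators]

theorem liftV_apply {n m m' : ℕ} (σ : Fin m → Proc 𝒩 n m') (X : Fin m) :
    liftV σ X = (σ X).vmap Fin.tail := rfl

theorem sensors_psubst_subset {n m : ℕ} (P : Proc 𝒩 n m) {T : Set 𝒩.Sensor} :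
    ∀ {m' : ℕ} (σ : Fin m → Proc 𝒩 n m'), P.sensors ⊆ T → (∀ X, (σ X).sensors ⊆ T) →
      (P.psubst σ).sensors ⊆ T := by
  induction P with
  | fix P ih =>
    intro m' σ h hσ
    refine ih _ h fun X => ?_
    cases X using Fin.cases with
    | zero => simp [liftP, sensors]
    | succ X => simpa [liftP, sensors_pren] using hσ X
  | _ =>
    intro m' σ h hσ
    simp_all only [psubst, sensors, liftV_apply, sensors_vmap, Set.union_subset_iff,
      Set.iUnion_subset_iff, implies_true, and_self]

theorem actuators_psubst_subset {n m : ℕ} (P : Proc 𝒩 n m) {T : Set 𝒩.Actuator} :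
    ∀ {m' : ℕ} (σ : Fin m → Proc 𝒩 n m'), P.actuators ⊆ T → (∀ X, (σ X).actuators ⊆ T) →
      (P.psubst σ).actuators ⊆ T := by
  induction P with
  | fix P ih =>
    intro m' σ h hσ
    refine ih _ h fun X => ?_
    cases X using Fin.cases with
    | zero => simp [liftP, actuators]
    | succ X => simpa [liftP, actuators_pren] using hσ X
  | _ =>
    intro m' σ h hσ
    simp_all only [psubst, actuators, liftV_apply, actuators_vmap, Set.union_subset_iff,
      Set.iUnion_subset_iff, implies_true, and_self]

theorem sensors_unfold_subset {n m : ℕ} (P : Proc 𝒩 n (m + 1)) :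
    P.unfold.sensors ⊆ P.sensors :=
  sensors_psubst_subset P _ subset_rfl fun X => by
    cases X using Fin.cases <;> simp [sensors]

theorem actuators_unfold_subset {n m : ℕ} (P : Proc 𝒩 n (m + 1)) :
    P.unfold.actuators ⊆ P.actuators :=
  actuators_psubst_subset P _ subset_rfl fun X => by
    cases X using Fin.cases <;> simp [actuators]

end Proc

/-- The only device that the label mentions, if any, is a sensor in `S` or an actuator in `A`. -/
def Label.Within {𝒩 : Signature.{u}} (S : Set 𝒩.Sensor) (A : Set 𝒩.Actuator) : Label 𝒩 → Prop
  | .read s _ => s ∈ S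
  | .write a _ => a ∈ A
  | _ => True

variable {𝒩 : Signature.{u}} {S : Set 𝒩.Sensor} {A : Set 𝒩.Actuator}

/-- The process mentions no sensor outside `S` and no actuator outside `A`. -/
def Proc.Within {n m : ℕ} (S : Set 𝒩.Sensor) (A : Set 𝒩.Actuator) (P : Proc 𝒩 n m) : Prop :=
  P.sensors ⊆ S ∧ P.actuators ⊆ A

theorem Proc.within_par {P Q : ClosedProc 𝒩} :
    (Proc.par P Q).Within S A ↔ P.Within S A ∧ Q.Within S A := by
  simp only [Within, sensors, actuators, Set.union_subset_iff]
  tauto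

theorem Proc.within_cond {b : Env 𝒩 0 → Bool} {P Q : ClosedProc 𝒩} :
    (Proc.cond b P Q).Within S A ↔ P.Within S A ∧ Q.Within S A := by
  simp only [Within, sensors, actuators, Set.union_subset_iff]
  tauto

theorem Proc.within_res {P : ClosedProc 𝒩} {c : 𝒩.Channel} :
    (Proc.res P c).Within S A ↔ P.Within S A := Iff.rfl

theorem PStep.within {P : ClosedProc 𝒩} {l : Label 𝒩} {π : Dist (ClosedProc 𝒩)}
    (h : PStep P l π) (hP : P.Within S A) :
    l.Within S A ∧ ∀ P' ∈ π.supp, P'.Within S A := by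
  induction h with
  | outp | inpp | read | write =>
    refine ⟨by simp_all [Label.Within, Proc.Within, Proc.sensors, Proc.actuators,
      Set.insert_subset_iff], ?_⟩
    intro P' hP'
    obtain ⟨i, rfl⟩ := Dist.exists_of_mem_supp_choice hP'
    simp_all only [Proc.Within, Proc.sensors, Proc.actuators, Proc.vsubst, Proc.sensors_vmap,
      Proc.actuators_vmap, Set.union_subset_iff, Set.iUnion_subset_iff, and_self]
  | fix _ ih =>
    exact ih ⟨(Proc.sensors_unfold_subset _).trans hP.1,
      (Proc.actuators_unfold_subset _).trans hP.2⟩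
  | _ =>
    simp only [Proc.within_par, Proc.within_cond, Proc.within_res] at hP
    grind [Dist.mem_supp_map₂, Dist.mem_supp_map, Dist.mem_supp_pure, Proc.within_par,
      Proc.within_res, Label.Within]

theorem PTick.within {P : ClosedProc 𝒩} {π : Dist (ClosedProc 𝒩)}
    (h : PTick P π) (hP : P.Within S A) : ∀ P' ∈ π.supp, P'.Within S A := by
  induction h with
  | delay | timeoutOut | timeoutInp =>
    intro P' hP'
    obtain ⟨i, rfl⟩ := Dist.exists_of_mem_supp_choice hP'
    simp_all only [Proc.Within, Proc.sensors, Proc.actuators, Set.iUnion_subset_iff,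
      Set.union_subset_iff, and_self]
  | fix _ ih =>
    exact ih ⟨(Proc.sensors_unfold_subset _).trans hP.1,
      (Proc.actuators_unfold_subset _).trans hP.2⟩
  | nil => simpa using hP
  | _ =>
    simp only [Proc.within_par, Proc.within_cond, Proc.within_res] at hP
    grind [Dist.mem_supp_map₂, Dist.mem_supp_map, Proc.within_par, Proc.within_res]

/-! ### Time-guarded recursion: termination between ticks, and patience -/

namespace Proc

theorem timeGuarded_vmap {n m : ℕ} (P : Proc 𝒩 n m) :
    ∀ {n' : ℕ} (g : Env 𝒩 n' → Env 𝒩 n) (X : Fin m),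
      (P.vmap g).TimeGuarded X ↔ P.TimeGuarded X := by
  induction P <;> intro n' g X <;> simp_all only [vmap, TimeGuarded]

theorem guardedRec_vmap {n m : ℕ} (P : Proc 𝒩 n m) :
    ∀ {n' : ℕ} (g : Env 𝒩 n' → Env 𝒩 n), (P.vmap g).GuardedRec ↔ P.GuardedRec := by
  induction P <;> intro n' g <;> simp_all only [vmap, GuardedRec, timeGuarded_vmap]

theorem liftRen_eq_zero {m m' : ℕ} {f : Fin m → Fin m'} {X : Fin (m + 1)}
    (h : liftRen f X = 0) : X = 0 := by
  cases X using Fin.cases with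
  | zero => rfl
  | succ X => exact absurd h (Fin.succ_ne_zero _)

theorem timeGuarded_pren {n m : ℕ} (P : Proc 𝒩 n m) :
    ∀ {m' : ℕ} {f : Fin m → Fin m'} {Y : Fin m'}, (∀ X, f X = Y → P.TimeGuarded X) →
      (P.pren f).TimeGuarded Y := by
  induction P with
  | fix P ih =>
    intro m' f Y h
    refine ih fun X hX => ?_
    cases X using Fin.cases with
    | zero => exact absurd hX.symm (Fin.succ_ne_zero _)
    | succ X => exact h X (Fin.succ_injective _ hX)
  | var X =>
    intro m' f Y h hY
    exact h X hY rfl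
  | _ => intro m' f Y h; simp only [pren, TimeGuarded] at * <;> grind

theorem guardedRec_pren {n m : ℕ} (P : Proc 𝒩 n m) :
    ∀ {m' : ℕ} (f : Fin m → Fin m'), P.GuardedRec → (P.pren f).GuardedRec := by
  induction P with
  | fix P ih =>
    intro m' f h
    exact ⟨timeGuarded_pren P fun X hX => liftRen_eq_zero hX ▸ h.1, ih _ h.2⟩
  | _ => intro m' f h; simp only [pren, GuardedRec] at * <;> grind

theorem timeGuarded_psubst {n m : ℕ} (P : Proc 𝒩 n m) :
    ∀ {m' : ℕ} {σ : Fin m → Proc 𝒩 n m'} {Y : Fin m'},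
      (∀ X, P.TimeGuarded X ∨ (σ X).TimeGuarded Y) → (P.psubst σ).TimeGuarded Y := by
  induction P with
  | fix P ih =>
    intro m' σ Y h
    refine ih fun X => ?_
    cases X using Fin.cases with
    | zero => exact .inr (Fin.succ_ne_zero Y).symm
    | succ X =>
      refine (h X).imp id fun h => timeGuarded_pren _ fun Z hZ => ?_
      rwa [Fin.succ_injective _ hZ]
  | var X =>
    intro m' σ Y h
    exact (h X).resolve_left fun h => h rfl
  | tick | nil => intros; trivial
  | _ =>
    intro m' σ Y h
    simp only [psubst, TimeGuarded] at *
    grind [timeGuarded_vmap, liftV_apply]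

theorem guardedRec_psubst {n m : ℕ} (P : Proc 𝒩 n m) :
    ∀ {m' : ℕ} {σ : Fin m → Proc 𝒩 n m'}, P.GuardedRec → (∀ X, (σ X).GuardedRec) →
      (P.psubst σ).GuardedRec := by
  induction P with
  | fix P ih =>
    intro m' σ h hσ
    refine ⟨timeGuarded_psubst P fun X => ?_, ih h.2 fun X => ?_⟩
    · cases X using Fin.cases with
      | zero => exact .inl h.1
      | succ X => exact .inr (timeGuarded_pren _ fun Z hZ => absurd hZ (Fin.succ_ne_zero _))
    · cases X using Fin.cases with
      | zero => trivial
      | succ X => exact guardedRec_pren _ _ (hσ X)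
  | inp c p C q D ihC ihD =>
    intro m' σ h hσ
    exact ⟨fun i => ihC i (h.1 i) fun X => (guardedRec_vmap _ _).2 (hσ X),
      fun i => ihD i (h.2 i) hσ⟩
  | read s p C ih =>
    intro m' σ h hσ
    exact fun i => ih i (h i) fun X => (guardedRec_vmap _ _).2 (hσ X)
  | _ => intro m' σ h hσ; simp only [psubst, GuardedRec] at * <;> grind

theorem GuardedRec.unfold {n m : ℕ} {P : Proc 𝒩 n (m + 1)} (h : (Proc.fix P).GuardedRec) :
    P.unfold.GuardedRec :=
  guardedRec_psubst P h.2 fun X => by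
    cases X using Fin.cases with
    | zero => exact h
    | succ X => trivial

/-- The size of the part of a term that can be executed before the next tick: what lies behind a
`tick` or in a timeout branch is not counted. Process variables have rank `0`, so that the
substitution for time-guarded variables does not change the rank. -/
def rank : {n m : ℕ} → Proc 𝒩 n m → ℕ
  | _, _, nil => 0
  | _, _, tick _ _ => 0
  | _, _, par P Q => P.rank + Q.rank + 1
  | _, _, outp _ _ _ C _ _ => (Finset.univ.sup fun i => (C i).rank) + 1
  | _, _, inp _ _ C _ _ => (Finset.univ.sup fun i => (C i).rank) + 1
  | _, _, read _ _ C => (Finset.univ.sup fun i => (C i).rank) + 1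
  | _, _, write _ _ _ C => (Finset.univ.sup fun i => (C i).rank) + 1
  | _, _, cond _ P Q => max P.rank Q.rank + 1
  | _, _, res P _ => P.rank + 1
  | _, _, var _ => 0
  | _, _, fix P => P.rank + 1

theorem rank_vmap {n m : ℕ} (P : Proc 𝒩 n m) :
    ∀ {n' : ℕ} (g : Env 𝒩 n' → Env 𝒩 n), (P.vmap g).rank = P.rank := by
  induction P <;> intro n' g <;> simp_all only [vmap, rank]

theorem rank_pren {n m : ℕ} (P : Proc 𝒩 n m) :
    ∀ {m' : ℕ} (f : Fin m → Fin m'), (P.pren f).rank = P.rank := by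
  induction P <;> intro m' f <;> simp_all only [pren, rank]

theorem rank_psubst {n m : ℕ} (P : Proc 𝒩 n m) :
    ∀ {m' : ℕ} {σ : Fin m → Proc 𝒩 n m'}, (∀ X, P.TimeGuarded X ∨ (σ X).rank = 0) →
      (P.psubst σ).rank = P.rank := by
  induction P with
  | fix P ih =>
    intro m' σ h
    refine congrArg (· + 1) (ih fun X => ?_)
    cases X using Fin.cases with
    | zero => exact .inr rfl
    | succ X => exact (h X).imp id fun h => (rank_pren _ _).trans h
  | var X =>
    intro m' σ h
    exact (h X).resolve_left fun h => h rfl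
  | tick | nil => intros; rfl
  | outp c e p C q D ihC ihD =>
    intro m' σ h
    simp only [psubst, rank]
    congr 2
    ext i
    exact ihC i fun X => (h X).imp (fun h => h i) id
  | inp c p C q D ihC ihD =>
    intro m' σ h
    simp only [psubst, rank]
    congr 2
    ext i
    exact ihC i fun X => (h X).imp (fun h => h i) fun h => (rank_vmap _ _).trans h
  | read s p C ih =>
    intro m' σ h
    simp only [psubst, rank]
    congr 2
    ext i
    exact ih i fun X => (h X).imp (fun h => h i) fun h => (rank_vmap _ _).trans h
  | write a e p C ih =>
    intro m' σ h
    simp only [psubst, rank]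
    congr 2
    ext i
    exact ih i fun X => (h X).imp (fun h => h i) id
  | par P Q ihP ihQ | cond b P Q ihP ihQ =>
    intro m' σ h
    simp only [psubst, rank]
    rw [ihP fun X => (h X).imp And.left id, ihQ fun X => (h X).imp And.right id]
  | res P c ih =>
    intro m' σ h
    simp only [psubst, rank]
    rw [ih h]

theorem rank_unfold {n m : ℕ} {P : Proc 𝒩 n (m + 1)} (h : P.TimeGuarded 0) :
    P.unfold.rank = P.rank :=
  rank_psubst P fun X => by
    cases X using Fin.cases with
    | zero => exact .inl h
    | succ X => exact .inr rfl

end Proc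

theorem rank_lt_sup_add_one {k n m : ℕ} (C : Fin k → Proc 𝒩 n m) (i : Fin k) :
    (C i).rank < (Finset.univ.sup fun i => (C i).rank) + 1 :=
  Nat.lt_succ_of_le (Finset.le_sup (f := fun i => (C i).rank) (Finset.mem_univ i))

theorem PStep.guardedRec {P : ClosedProc 𝒩} {l : Label 𝒩} {π : Dist (ClosedProc 𝒩)}
    (h : PStep P l π) (hP : P.GuardedRec) :
    ∀ P' ∈ π.supp, P'.GuardedRec ∧ P'.rank < P.rank := by
  induction h with
  | outp | inpp | read | write =>
    intro P' hP'
    obtain ⟨i, rfl⟩ := Dist.exists_of_mem_supp_choice hP'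
    simp only [Proc.GuardedRec] at hP
    simp only [Proc.vsubst, Proc.guardedRec_vmap, Proc.rank_vmap, Proc.rank]
    exact ⟨by grind, rank_lt_sup_add_one _ i⟩
  | fix _ ih =>
    intro P' hP'
    have := ih hP.unfold P' hP'
    rw [Proc.rank_unfold hP.1] at this
    exact ⟨this.1, Nat.lt_succ_of_lt this.2⟩
  | _ =>
    simp only [Proc.GuardedRec] at hP
    simp only [Proc.rank] at *
    grind [Dist.mem_supp_map₂, Dist.mem_supp_map, Dist.mem_supp_pure, Proc.GuardedRec, Proc.rank]

theorem PTick.guardedRec {P : ClosedProc 𝒩} {π : Dist (ClosedProc 𝒩)}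
    (h : PTick P π) (hP : P.GuardedRec) : ∀ P' ∈ π.supp, P'.GuardedRec := by
  induction h with
  | delay | timeoutOut | timeoutInp =>
    intro P' hP'
    obtain ⟨i, rfl⟩ := Dist.exists_of_mem_supp_choice hP'
    simp_all only [Proc.GuardedRec]
  | fix _ ih => exact ih hP.unfold
  | _ =>
    simp only [Proc.GuardedRec] at hP
    grind [Dist.mem_supp_map₂, Dist.mem_supp_map, Dist.mem_supp_pure, Proc.GuardedRec]

/-- Maximal progress: a process that can let time pass has no `τ` transition. -/
theorem PTick.not_tau {P : ClosedProc 𝒩} {π : Dist (ClosedProc 𝒩)} (h : PTick P π) :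
    ¬ ∃ π', PStep P .tau π' := by
  induction h with
  | par _ _ h => exact h
  | nil | delay | timeoutOut | timeoutInp => rintro ⟨π', ⟨⟩⟩
  | res _ ih =>
    rintro ⟨π', h⟩
    cases h with | res h _ => exact ih ⟨_, h⟩
  | fix _ ih =>
    rintro ⟨π', h⟩
    cases h with | fix h => exact ih ⟨_, h⟩
  | condT hb _ ih =>
    rintro ⟨π', h⟩
    cases h with
    | condT _ h => exact ih ⟨_, h⟩
    | condF hb' _ => simp [hb] at hb'
  | condF hb _ ih =>
    rintro ⟨π', h⟩
    cases h with
    | condF _ h => exact ih ⟨_, h⟩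
    | condT hb' _ => simp [hb] at hb'

/-- Patience: a time-guarded process can let time pass if it has no `τ` transition, no write and
no reading. For the readings it suffices to consider one value `f s` for each sensor `s`. -/
theorem exists_pTick {P : ClosedProc 𝒩} (hP : P.GuardedRec) (f : 𝒩.Sensor → Value 𝒩)
    (hτ : ¬ ∃ π, PStep P .tau π) (hr : ¬ ∃ s π, PStep P (.read s (f s)) π)
    (hw : ¬ ∃ a r π, PStep P (.write a r) π) : ∃ π, PTick P π := by
  induction hk : P.rank using Nat.strong_induction_on generalizing P with
  | _ k ih =>
  subst hk
  cases P with
  | nil => exact ⟨_, .nil⟩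
  | tick p C => exact ⟨_, .delay p C⟩
  | outp c e p C q D => exact ⟨_, .timeoutOut c e p C q D⟩
  | inp c p C q D => exact ⟨_, .timeoutInp c p C q D⟩
  | read s p C => exact absurd ⟨s, _, .read s (f s) p C⟩ hr
  | write a e p C => exact absurd ⟨a, _, _, .write a e p C⟩ hw
  | var X => exact X.elim0
  | par P Q =>
    obtain ⟨π₁, h₁⟩ := ih P.rank (by simp only [Proc.rank]; lia) hP.1
      (fun ⟨_, h⟩ => hτ ⟨_, .parL h⟩) (fun ⟨_, _, h⟩ => hr ⟨_, _, .parL h⟩)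
      (fun ⟨_, _, _, h⟩ => hw ⟨_, _, _, .parL h⟩) rfl
    obtain ⟨π₂, h₂⟩ := ih Q.rank (by simp only [Proc.rank]; lia) hP.2
      (fun ⟨_, h⟩ => hτ ⟨_, .parR h⟩) (fun ⟨_, _, h⟩ => hr ⟨_, _, .parR h⟩)
      (fun ⟨_, _, _, h⟩ => hw ⟨_, _, _, .parR h⟩) rfl
    exact ⟨_, .par h₁ h₂ hτ⟩
  | cond b P Q =>
    cases hb : b Fin.elim0 with
    | true =>
      obtain ⟨π, h⟩ := ih P.rank (by simp only [Proc.rank]; lia) hP.1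
        (fun ⟨_, h⟩ => hτ ⟨_, .condT hb h⟩) (fun ⟨_, _, h⟩ => hr ⟨_, _, .condT hb h⟩)
        (fun ⟨_, _, _, h⟩ => hw ⟨_, _, _, .condT hb h⟩) rfl
      exact ⟨_, .condT hb h⟩
    | false =>
      obtain ⟨π, h⟩ := ih Q.rank (by simp only [Proc.rank]; lia) hP.2
        (fun ⟨_, h⟩ => hτ ⟨_, .condF hb h⟩) (fun ⟨_, _, h⟩ => hr ⟨_, _, .condF hb h⟩)
        (fun ⟨_, _, _, h⟩ => hw ⟨_, _, _, .condF hb h⟩) rfl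
      exact ⟨_, .condF hb h⟩
  | res P c =>
    obtain ⟨π, h⟩ := ih (P := P) P.rank (by simp only [Proc.rank]; lia) hP
      (fun ⟨_, h'⟩ => hτ ⟨_, .res h' (by simp [Label.IsOn])⟩)
      (fun ⟨_, _, h'⟩ => hr ⟨_, _, .res h' (by simp [Label.IsOn])⟩)
      (fun ⟨_, _, _, h'⟩ => hw ⟨_, _, _, .res h' (by simp [Label.IsOn])⟩) rfl
    exact ⟨_, .res h⟩
  | fix P =>
    obtain ⟨π, h⟩ := ih P.unfold.rank
      (by rw [Proc.rank_unfold hP.1]; simp only [Proc.rank]; lia) hP.unfold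
      (fun ⟨_, h⟩ => hτ ⟨_, .fix h⟩) (fun ⟨_, _, h⟩ => hr ⟨_, _, .fix h⟩)
      (fun ⟨_, _, _, h⟩ => hw ⟨_, _, _, .fix h⟩) rfl
    exact ⟨_, .fix h⟩

/-! ### Weak transitions between full distributions -/

/-- The weak transition `γ =τ̂⇒ γ'` between full distributions. -/
def WTau : Dist (CPS 𝒩) → Dist (CPS 𝒩) → Prop := Relation.ReflTransGen (Lift (HatStep .tau))

/-- The weak transition `γ =α̂⇒ γ'` between full distributions. The shape `=τ̂⇒ -α̂→ =τ̂⇒` serves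
for `α = τ` as well, see `weak_tau`. -/
def Weak (α : Action 𝒩) (γ γ' : Dist (CPS 𝒩)) : Prop :=
  ∃ γ₁ γ₂, WTau γ γ₁ ∧ Lift (HatStep α) γ₁ γ₂ ∧ WTau γ₂ γ'

theorem hatStep_tau_pure (M : CPS 𝒩) : HatStep .tau M (Dist.pure M) := .inr ⟨rfl, rfl⟩

theorem Lift.hat_refl (γ : Dist (CPS 𝒩)) : Lift (HatStep .tau) γ γ := Lift.refl hatStep_tau_pure γ

theorem weak_tau {γ γ' : Dist (CPS 𝒩)} : Weak .tau γ γ' ↔ WTau γ γ' :=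
  ⟨fun ⟨_, _, h₁, h, h₂⟩ => (h₁.tail h).trans h₂, fun h => ⟨_, _, h, .hat_refl _, .refl⟩⟩

theorem WTau.bind {C : Type u} {η : Dist C} {F G : C → Dist (CPS 𝒩)}
    (h : ∀ c ∈ η.supp, WTau (F c) (G c)) : WTau (η.bind F) (η.bind G) := by
  classical
  -- one component moves at a time, while the others stay idle
  have one (H : C → Dist (CPS 𝒩)) (c : C) {γ γ' : Dist (CPS 𝒩)} (hγ : WTau γ γ') :
      WTau (η.bind (Function.update H c γ)) (η.bind (Function.update H c γ')) := by
    refine Relation.ReflTransGen.lift (fun γ => η.bind (Function.update H c γ)) ?_ _ _ hγ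
    intro γ γ' h
    refine Lift.bind fun d _ => ?_
    by_cases hd : d = c
    · subst hd
      simpa using h
    · simpa [hd] using Lift.hat_refl _
  have key (s : Finset C) (hs : ∀ c ∈ s, c ∈ η.supp) :
      WTau (η.bind F) (η.bind fun c => if c ∈ s then G c else F c) := by
    induction s using Finset.induction_on with
    | empty =>
      simp only [Finset.notMem_empty, if_false]
      exact .refl
    | insert c s hc ih =>
      refine (ih fun d hd => hs d (Finset.mem_insert_of_mem hd)).trans ?_
      have := one (fun d => if d ∈ s then G d else F d) c (h c (hs c (Finset.mem_insert_self _ _)))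
      have h₁ : Function.update (fun d => if d ∈ s then G d else F d) c (F c) =
          fun d => if d ∈ s then G d else F d := by
        rw [Function.update_eq_self_iff, if_neg hc]
      have h₂ : Function.update (fun d => if d ∈ s then G d else F d) c (G c) =
          fun d => if d ∈ insert c s then G d else F d := by
        ext1 d
        by_cases hd : d = c
        · subst hd
          simp
        · simp [hd]
      rwa [h₁, h₂] at this
  have := key η.1.support fun c hc => Finsupp.mem_support_iff.1 hc
  rwa [Dist.bind_congr (f := fun c => if c ∈ η.1.support then G c else F c) (g := G)
    fun c hc => if_pos (Finsupp.mem_support_iff.2 hc)] at this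

/-- A property of states that `τ` steps preserve is preserved by weak `τ` transitions. -/
theorem WTau.forall_supp {I : CPS 𝒩 → Prop}
    (hI : ∀ M γ, I M → Step M .tau γ → ∀ M' ∈ γ.supp, I M') {γ γ' : Dist (CPS 𝒩)}
    (h : WTau γ γ') (hγ : ∀ M ∈ γ.supp, I M) : ∀ M ∈ γ'.supp, I M := by
  induction h with
  | refl => exact hγ
  | tail _ h ih =>
    intro M' hM'
    obtain ⟨M, hM, δ, hδ | ⟨-, rfl⟩, hM'⟩ := h.exists_left hM'
    · exact hI M δ (ih M hM) hδ M' hM'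
    · rw [Dist.mem_supp_pure.1 hM']
      exact ih M hM

/-- A map of states that respects the `τ` steps of all states with a `τ`-invariant property `I`
respects weak `τ` transitions. -/
theorem WTau.map {I : CPS 𝒩 → Prop} {f : CPS 𝒩 → CPS 𝒩}
    (hI : ∀ M γ, I M → Step M .tau γ → ∀ M' ∈ γ.supp, I M')
    (hf : ∀ M γ, I M → Step M .tau γ → HatStep .tau (f M) (γ.map f)) {γ γ' : Dist (CPS 𝒩)}
    (h : WTau γ γ') (hγ : ∀ M ∈ γ.supp, I M) : WTau (γ.map f) (γ'.map f) := by
  induction h with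
  | refl => exact .refl
  | tail h₁ h ih =>
    refine ih.tail (h.bind_bind fun M hM δ hδ => Lift.of_rel ?_)
    obtain hδ | ⟨-, rfl⟩ := hδ
    · exact hf M δ (WTau.forall_supp hI h₁ hγ M hM) hδ
    · rw [Dist.pure_bind]
      exact hatStep_tau_pure _

/-! ### Comparison with weak transitions between sub-distributions -/

theorem liftStep_toSub {α : Action 𝒩} {γ γ' : Dist (CPS 𝒩)} (h : Lift (HatStep α) γ γ') :
    LiftStep α γ.toSub γ'.toSub := by
  classical
  obtain ⟨ω, rfl, rfl, h⟩ := h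
  let e := ω.1.support.equivFin
  refine ⟨_, fun i => ω.1 (e.symm i).1, fun i => (e.symm i).1.1, Finset.univ,
    fun i => (e.symm i).1.2, ?_, ?_, ?_, ?_, ?_, ?_⟩
  · intro i
    exact pos_iff_ne_zero.2 (Finsupp.mem_support_iff.1 (e.symm i).2)
  · rw [e.symm.sum_comp fun x => Finsupp.single x.1.1 (ω.1 x.1),
      Finset.sum_coe_sort ω.1.support fun x => Finsupp.single x.1 (ω.1 x)]
    simp only [Dist.toSub, Dist.map, Dist.bind, Dist.pure, Finsupp.smul_single, smul_eq_mul,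
      mul_one]
  · obtain ⟨x, hx⟩ := ω.supp_nonempty
    exact ⟨e ⟨x, Finsupp.mem_support_iff.2 hx⟩, Finset.mem_univ _⟩
  · intro i _
    exact h _ (Finsupp.mem_support_iff.1 (e.symm i).2)
  · intro i hi
    exact absurd (Finset.mem_univ i) hi
  · rw [e.symm.sum_comp fun x => ω.1 x.1 • x.1.2.1,
      Finset.sum_coe_sort ω.1.support fun x => ω.1 x • x.2.1]
    rfl

/-- If a lifted step ends in a full distribution then it starts in one, and all the states of its
decomposition move. -/
theorem LiftStep.exists_lift {α : Action 𝒩} {γ : SubDist (CPS 𝒩)} {γ' : Dist (CPS 𝒩)}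
    (h : LiftStep α γ γ'.toSub) :
    ∃ δ : Dist (CPS 𝒩), γ = δ.toSub ∧ Lift (HatStep α) δ γ' := by
  classical
  obtain ⟨n, p, M, J, δ, hp, hγ, -, hstep, -, hγ'⟩ := h
  have hγm : mass γ.1 = ∑ i, p i := by
    rw [hγ, mass_finset_sum]
    exact Finset.sum_congr rfl fun i _ => mass_single _ _
  have hJm : ∑ i ∈ J, p i = 1 := by
    rw [← γ'.2, show γ'.1 = γ'.toSub.1 from rfl, hγ', mass_finset_sum]
    exact Finset.sum_congr rfl fun i _ => by rw [mass_smul, (δ i).2, mul_one]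
  have hle : ∑ i ∈ J, p i ≤ ∑ i, p i :=
    Finset.sum_le_sum_of_subset (Finset.subset_univ J)
  have h1 : ∑ i, p i = 1 := le_antisymm (hγm ▸ γ.2.2) (hJm ▸ hle)
  have hJ : J = Finset.univ := by
    by_contra hne
    obtain ⟨i, -, hi⟩ := Finset.exists_of_ssubset
      ((Finset.subset_univ J).ssubset_of_ne hne)
    have := Finset.sum_lt_sum_of_subset (f := p) (Finset.subset_univ J) (Finset.mem_univ i) hi
      (hp i) fun _ _ _ => zero_le
    rw [hJm, h1] at this
    exact lt_irrefl _ this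
  subst hJ
  let W : Weights n := ⟨p, hp, h1⟩
  have hmap {B : Type u} (f : CPS 𝒩 × Dist (CPS 𝒩) → Dist B) :
      ((Dist.choice W fun i => (M i, δ i)).bind f).1 = ∑ i, p i • (f (M i, δ i)).1 := by
    rw [Dist.bind_val]
    refine (Finsupp.sum_finsetSum_index (h := fun a (q : ℝ≥0) => q • (f a).1)
      (fun _ => zero_smul _ _) (fun _ _ _ => add_smul _ _ _)).symm.trans ?_
    exact Finset.sum_congr rfl fun i _ => Finsupp.sum_single_index (zero_smul _ _)
  refine ⟨⟨γ.1, hγm.trans h1⟩, rfl, Dist.choice W fun i => (M i, δ i), ?_, ?_, ?_⟩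
  · refine Subtype.ext ((hmap _).trans (Eq.trans ?_ hγ.symm))
    exact Finset.sum_congr rfl fun i _ => by simp [Dist.pure_val]
  · exact Subtype.ext ((hmap _).trans hγ'.symm)
  · intro x hx
    obtain ⟨i, rfl⟩ := Dist.exists_of_mem_supp_choice hx
    exact hstep i (Finset.mem_univ i)

theorem toSub_injective : Function.Injective (Dist.toSub (A := CPS 𝒩)) := fun _ _ h =>
  Subtype.ext (congrArg (fun γ : SubDist (CPS 𝒩) => γ.1) h)

theorem WeakTau.exists_wTau {γ : SubDist (CPS 𝒩)} {γ' : Dist (CPS 𝒩)}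
    (h : WeakTau γ γ'.toSub) : ∃ δ : Dist (CPS 𝒩), γ = δ.toSub ∧ WTau δ γ' := by
  induction h using Relation.ReflTransGen.head_induction_on with
  | refl => exact ⟨γ', rfl, .refl⟩
  | head h _ ih =>
    obtain ⟨δ, rfl, hδ⟩ := ih
    obtain ⟨ε, rfl, hε⟩ := h.exists_lift
    exact ⟨ε, rfl, .head hε hδ⟩

theorem weakTau_toSub {γ γ' : Dist (CPS 𝒩)} (h : WTau γ γ') : WeakTau γ.toSub γ'.toSub :=
  Relation.ReflTransGen.lift Dist.toSub (fun _ _ => liftStep_toSub) _ _ h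

theorem weakStep_toSub_iff {α : Action 𝒩} {γ γ' : Dist (CPS 𝒩)} :
    WeakStep α γ.toSub γ'.toSub ↔ Weak α γ γ' := by
  constructor
  · rintro (⟨rfl, h⟩ | ⟨-, γ₁, γ₂, h₁, h, h₂⟩)
    · obtain ⟨δ, hδ, h⟩ := h.exists_wTau
      rw [toSub_injective hδ]
      exact weak_tau.2 h
    · obtain ⟨δ₂, rfl, h₂'⟩ := h₂.exists_wTau
      obtain ⟨δ₁, rfl, h'⟩ := h.exists_lift
      obtain ⟨δ, hδ, h₁'⟩ := h₁.exists_wTau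
      rw [toSub_injective hδ]
      exact ⟨_, _, h₁', h', h₂'⟩
  · intro h
    by_cases hα : α = .tau
    · subst hα
      exact .inl ⟨rfl, weakTau_toSub (weak_tau.1 h)⟩
    · obtain ⟨γ₁, γ₂, h₁, h, h₂⟩ := h
      exact .inr ⟨hα, _, _, weakTau_toSub h₁, liftStep_toSub h, weakTau_toSub h₂⟩

theorem isWeakBisimulation_iff {R : CPS 𝒩 → CPS 𝒩 → Prop} :
    IsWeakBisimulation R ↔ (∀ M N, R M N → R N M) ∧
      ∀ M N, R M N → ∀ α γ, Step M α γ →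
        ∃ γ', Weak α (Dist.pure N) γ' ∧ Coupled R γ γ' := by
  refine and_congr Iff.rfl (forall_congr' fun M => forall_congr' fun N => forall_congr' fun _ =>
    forall_congr' fun α => forall_congr' fun γ => forall_congr' fun _ => exists_congr fun γ' => ?_)
  simp only [weakStep_toSub_iff, IsMatching, Coupled, Prod.forall, ← Dist.mem_supp_iff_pos]
  tauto

/-! ### Transitions of cyber-physical systems in terms of those of their processes -/

section

variable {X : Set 𝒩.StateVar} {S : Set 𝒩.Sensor} {A : Set 𝒩.Actuator}

/-- In the physical state `st`, a process transition with label `l` counts as the action `α` of the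
system and leads to the physical state `st'`. -/
inductive Perform (st : PhysState X S A) : Label 𝒩 → Action 𝒩 → PhysState X S A → Prop
  | tau : Perform st .tau .tau st
  | out (c : 𝒩.Channel) (v : Value 𝒩) : Perform st (.out c v) (.out c v) st
  | inp (c : 𝒩.Channel) (v : Value 𝒩) : Perform st (.inp c v) (.inp c v) st
  | read (s : S) : Perform st (.read s (.real (st.sensorFun s))) .tau st
  | write (a : A) (r : ℝ) : Perform st (.write a r) .tau (st.setActuator a r)

theorem Perform.stateFun_eq {st st' : PhysState X S A} {l : Label 𝒩} {α : Action 𝒩}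
    (h : Perform st l α st') : st'.stateFun = st.stateFun := by
  cases h <;> rfl

theorem conf_pure (E : PhysEnv X S A) (st : PhysState X S A) (π : Dist (ClosedProc 𝒩)) :
    conf E (Dist.pure st) π = π.map (CPS.mk E st) := by
  simp [conf, Dist.map₂_eq_bind, Dist.map_eq_bind]

/-- Systems whose invariant holds; `Dead` is not alive. -/
def CPS.Alive : CPS 𝒩 → Prop
  | .dead => False
  | .mk E st _ => st.stateFun ∈ E.inv

theorem step_mk_iff {E : PhysEnv X S A} {st : PhysState X S A} {P : ClosedProc 𝒩}
    {α : Action 𝒩} {γ : Dist (CPS 𝒩)} (hinv : st.stateFun ∈ E.inv) (hα : α ≠ .tick) :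
    Step (.mk E st P) α γ ↔
      ∃ l st' π, Perform st l α st' ∧ PStep P l π ∧ γ = π.map (CPS.mk E st') := by
  constructor
  · intro h
    cases h with
    | tau h =>
      cases h with
      | tau h _ => exact ⟨_, _, _, .tau, h, conf_pure ..⟩
      | sensRead s h _ => exact ⟨_, _, _, .read s, h, conf_pure ..⟩
      | actWrite a r h _ => exact ⟨_, _, _, .write a r, h, conf_pure ..⟩
      | deadlock h => exact absurd hinv h
    | out h _ => exact ⟨_, _, _, .out .., h, conf_pure ..⟩
    | inp h _ => exact ⟨_, _, _, .inp .., h, conf_pure ..⟩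
    | time => exact absurd rfl hα
  · rintro ⟨l, st', π, hp, h, rfl⟩
    rw [← conf_pure]
    cases hp with
    | tau => exact .tau (.tau h hinv)
    | out => exact .out h hinv
    | inp => exact .inp h hinv
    | read s => exact .tau (.sensRead s h hinv)
    | write a r => exact .tau (.actWrite a r h hinv)

theorem step_tau_iff {M : CPS 𝒩} {γ : Dist (CPS 𝒩)} : Step M .tau γ ↔ TauStep M γ :=
  ⟨fun h => by cases h; assumption, .tau⟩

/-- The system has no `τ` transition. -/
def CPS.Stable (M : CPS 𝒩) : Prop := ¬ ∃ γ, Step M .tau γ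

theorem step_tick_iff {E : PhysEnv X S A} {st : PhysState X S A} {P : ClosedProc 𝒩}
    {γ : Dist (CPS 𝒩)} :
    Step (.mk E st P) .tick γ ↔ st.stateFun ∈ E.inv ∧ (CPS.mk E st P).Stable ∧
      ∃ π, PTick P π ∧ γ = conf E (E.next st) π := by
  simp only [CPS.Stable, step_tau_iff]
  constructor
  · intro h
    cases h with | time h hτ hinv => exact ⟨hinv, hτ, _, h, rfl⟩
  · rintro ⟨hinv, hτ, π, h, rfl⟩
    exact .time h hτ hinv

end

theorem not_step_dead {α : Action 𝒩} {γ : Dist (CPS 𝒩)} : ¬ Step .dead α γ := by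
  rintro (h | _ | _ | _)
  cases h

theorem Step.eq_of_not_alive {M : CPS 𝒩} {α : Action 𝒩} {γ : Dist (CPS 𝒩)}
    (h : Step M α γ) (hM : ¬ M.Alive) : α = .tau ∧ γ = Dist.pure .dead := by
  cases h with
  | tau h =>
    cases h with
    | deadlock _ => exact ⟨rfl, rfl⟩
    | tau _ h | sensRead _ _ h | actWrite _ _ _ h => exact absurd h hM
  | out _ h | inp _ h | time _ _ h => exact absurd h hM

theorem step_dead_of_not_alive {M : CPS 𝒩} (hM : ¬ M.Alive) (hne : M ≠ .dead) :
    Step M .tau (Dist.pure .dead) := by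
  cases M with
  | dead => exact absurd rfl hne
  | mk E st P => exact .tau (.deadlock hM)

theorem Step.stable {M : CPS 𝒩} {γ : Dist (CPS 𝒩)} (h : Step M .tick γ) : M.Stable := by
  cases M with
  | dead => exact absurd h not_step_dead
  | mk E st P => exact (step_tick_iff.1 h).2.1

theorem Step.alive {M : CPS 𝒩} {α : Action 𝒩} {γ : Dist (CPS 𝒩)} (h : Step M α γ)
    (hα : α ≠ .tau) : M.Alive :=
  by_contra fun hM => hα (h.eq_of_not_alive hM).1

/-! ### Invariants of the transitions of cyber-physical systems -/

/-- The part of a system that can be executed before the next tick, see `Proc.rank`. -/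
def CPS.rank : CPS 𝒩 → ℕ
  | .dead => 0
  | .mk _ _ P => P.rank

/-- The sensors and the actuators that the process mentions belong to the physical component. -/
def CPS.Within : CPS 𝒩 → Prop
  | .dead => True
  | @CPS.mk _ _ S A _ _ P => P.Within S A

theorem CPS.WellFormed.within {M : CPS 𝒩} (h : M.WellFormed) : M.Within := by
  cases M with
  | dead => trivial
  | mk E st P => exact ⟨h.1, h.2.1⟩

/-- A step of `E; S ⋈ P` leads to `Dead`, or it is caused by a transition of `P` and leaves the
physical environment unchanged. -/
theorem Step.exists_of_mem_supp {X : Set 𝒩.StateVar} {S : Set 𝒩.Sensor} {A : Set 𝒩.Actuator}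
    {E : PhysEnv X S A} {st : PhysState X S A} {P : ClosedProc 𝒩} {α : Action 𝒩}
    {γ : Dist (CPS 𝒩)} (h : Step (.mk E st P) α γ) {M' : CPS 𝒩} (hM' : M' ∈ γ.supp) :
    M' = .dead ∨ ∃ st' π, ∃ P' ∈ π.supp, M' = .mk E st' P' ∧
      ((∃ l, PStep P l π) ∧ st'.stateFun = st.stateFun ∨ PTick P π ∧ α = .tick) := by
  by_cases hinv : st.stateFun ∈ E.inv
  · right
    by_cases hα : α = .tick
    · subst hα
      obtain ⟨-, -, π, hπ, rfl⟩ := step_tick_iff.1 h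
      obtain ⟨st', -, P', hP', rfl⟩ := Dist.mem_supp_map₂.1 hM'
      exact ⟨st', π, P', hP', rfl, .inr ⟨hπ, rfl⟩⟩
    · obtain ⟨l, st', π, hp, hπ, rfl⟩ := (step_mk_iff hinv hα).1 h
      obtain ⟨P', hP', rfl⟩ := Dist.mem_supp_map.1 hM'
      exact ⟨st', π, P', hP', rfl, .inl ⟨⟨l, hπ⟩, hp.stateFun_eq⟩⟩
  · obtain ⟨-, rfl⟩ := h.eq_of_not_alive hinv
    exact .inl (Dist.mem_supp_pure.1 hM')

theorem Step.within {M : CPS 𝒩} {α : Action 𝒩} {γ : Dist (CPS 𝒩)} (h : Step M α γ)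
    (hM : M.Within) {M' : CPS 𝒩} (hM' : M' ∈ γ.supp) : M'.Within := by
  cases M with
  | dead => exact absurd h not_step_dead
  | mk E st P =>
    obtain rfl | ⟨st', π, P', hP', rfl, ⟨⟨l, h⟩, -⟩ | ⟨h, -⟩⟩ := h.exists_of_mem_supp hM'
    · trivial
    · exact (h.within hM).2 P' hP'
    · exact h.within hM P' hP'

theorem Step.wellFormed {M : CPS 𝒩} {α : Action 𝒩} {γ : Dist (CPS 𝒩)} (h : Step M α γ)
    (hM : M.WellFormed) {M' : CPS 𝒩} (hM' : M' ∈ γ.supp) : M'.WellFormed := by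
  have hw := h.within hM.within hM'
  cases M with
  | dead => exact absurd h not_step_dead
  | mk E st P =>
    obtain rfl | ⟨st', π, P', hP', rfl, ⟨⟨l, h⟩, -⟩ | ⟨h, -⟩⟩ := h.exists_of_mem_supp hM'
    · trivial
    · exact ⟨hw.1, hw.2, (h.guardedRec hM.2.2 P' hP').1⟩
    · exact ⟨hw.1, hw.2, h.guardedRec hM.2.2 P' hP'⟩

theorem Step.physDisjoint {M O : CPS 𝒩} {α : Action 𝒩} {γ : Dist (CPS 𝒩)} (h : Step M α γ)
    (hM : M.PhysDisjoint O) {M' : CPS 𝒩} (hM' : M' ∈ γ.supp) : M'.PhysDisjoint O := by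
  cases M with
  | dead => exact absurd h not_step_dead
  | mk E st P =>
    obtain rfl | ⟨st', π, P', -, rfl, -⟩ := h.exists_of_mem_supp hM'
    · trivial
    · cases O <;> exact hM

theorem CPS.PhysDisjoint.symm {M O : CPS 𝒩} (h : M.PhysDisjoint O) : O.PhysDisjoint M := by
  cases M <;> cases O <;> first | trivial | exact ⟨h.1.symm, h.2.1.symm, h.2.2.symm⟩

/-- Between ticks a system that is alive remains so, and its rank decreases. -/
theorem Step.alive_and_rank_lt {M : CPS 𝒩} {γ : Dist (CPS 𝒩)} (h : Step M .tau γ)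
    (hM : M.WellFormed) (ha : M.Alive) {M' : CPS 𝒩} (hM' : M' ∈ γ.supp) :
    M'.Alive ∧ M'.rank < M.rank := by
  cases M with
  | dead => exact absurd h not_step_dead
  | mk E st P =>
    obtain ⟨l, st', π, hp, hπ, rfl⟩ := (step_mk_iff ha (by simp)).1 h
    obtain ⟨P', hP', rfl⟩ := Dist.mem_supp_map.1 hM'
    refine ⟨?_, (hπ.guardedRec hM.2.2 P' hP').2⟩
    rwa [CPS.Alive, hp.stateFun_eq]

/-- A well-formed system that is alive and stable can let time pass. -/
theorem exists_step_tick {M : CPS 𝒩} (hM : M.WellFormed) (ha : M.Alive) (hs : M.Stable) :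
    ∃ γ, Step M .tick γ := by
  classical
  cases M with
  | dead => exact ha.elim
  | @mk X S A E st P =>
    have no (l : Label 𝒩) (st' : PhysState X S A) (hp : Perform st l .tau st')
        (π : Dist (ClosedProc 𝒩)) : ¬ PStep P l π := fun h =>
      hs ⟨_, (step_mk_iff ha (by simp)).2 ⟨l, st', π, hp, h, rfl⟩⟩
    obtain ⟨π, h⟩ := exists_pTick hM.2.2
      (fun s => .real (if hs : s ∈ S then st.sensorFun ⟨s, hs⟩ else 0))
      (fun ⟨π, h⟩ => no _ _ .tau π h)
      (fun ⟨s, π, h⟩ => by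
        have hs : s ∈ S := (h.within hM.within).1
        rw [dif_pos hs] at h
        exact no _ _ (.read ⟨s, hs⟩) π h)
      (fun ⟨a, r, π, h⟩ => no _ _ (.write ⟨a, (h.within hM.within).1⟩ r) π h)
    exact ⟨_, step_tick_iff.2 ⟨ha, hs, π, h, rfl⟩⟩

/-! ### Stable systems and systems that are not alive under bisimulations -/

theorem Dist.eq_pure {O : Type u} {δ : Dist O} {a : O} (h : ∀ b ∈ δ.supp, b = a) :
    δ = Dist.pure a := by
  rw [← Dist.bind_pure δ, Dist.bind_congr (g := fun _ => Dist.pure a) fun b hb => by rw [h b hb],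
    Dist.bind_const]

theorem CPS.Stable.eq_pure {M : CPS 𝒩} (hM : M.Stable) {γ : Dist (CPS 𝒩)}
    (h : WTau (Dist.pure M) γ) : γ = Dist.pure M := by
  refine Dist.eq_pure (h.forall_supp (I := fun M' => M' = M) ?_ fun _ => Dist.mem_supp_pure.1)
  rintro _ γ rfl h
  exact absurd ⟨γ, h⟩ hM

theorem CPS.Stable.exists_step {M : CPS 𝒩} (hM : M.Stable) {α : Action 𝒩} (hα : α ≠ .tau)
    {γ : Dist (CPS 𝒩)} (h : Weak α (Dist.pure M) γ) : ∃ δ, Step M α δ := by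
  obtain ⟨γ₁, γ₂, h₁, h, -⟩ := h
  rw [hM.eq_pure h₁] at h
  obtain ⟨δ, h | h⟩ := h.exists_rel (Dist.mem_supp_pure.2 rfl)
  · exact ⟨δ, h⟩
  · exact absurd h.1 hα

theorem stable_dead : (CPS.dead : CPS 𝒩).Stable := fun ⟨_, h⟩ => not_step_dead h

variable {R : CPS 𝒩 → CPS 𝒩 → Prop}

theorem IsWeakBisimulation.exists_weak (hR : IsWeakBisimulation R) {M N : CPS 𝒩} (h : R M N)
    {α : Action 𝒩} {γ : Dist (CPS 𝒩)} (hM : Step M α γ) :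
    ∃ γ', Weak α (Dist.pure N) γ' ∧ Coupled R γ γ' :=
  (isWeakBisimulation_iff.1 hR).2 M N h α γ hM

/-- A stable system is related to everything that a related system can become by weak `τ`
transitions. -/
theorem IsWeakBisimulation.rel_of_wTau (hR : IsWeakBisimulation R) {M N : CPS 𝒩} (h : R M N)
    (hM : M.Stable) {γ : Dist (CPS 𝒩)} (hγ : WTau (Dist.pure N) γ) : ∀ N' ∈ γ.supp, R M N' := by
  refine hγ.forall_supp (I := fun N' => R M N') ?_ fun N' hN' => Dist.mem_supp_pure.1 hN' ▸ h
  intro N₁ δ hN₁ hδ N' hN'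
  obtain ⟨γ', hγ', hc⟩ := hR.exists_weak (hR.1 _ _ hN₁) hδ
  rw [hM.eq_pure (weak_tau.1 hγ')] at hc
  obtain ⟨M', hM', h⟩ := hc.exists_right hN'
  rw [Dist.mem_supp_pure.1 hM'] at h
  exact hR.1 _ _ h

/-- Time-guardedness makes a well-formed system that is alive reach a stable state after finitely
many `τ` transitions, where it can let time pass, which `Dead` cannot. -/
theorem IsWeakBisimulation.not_alive_of_rel_dead (hR : IsWeakBisimulation R) {M : CPS 𝒩}
    (hM : M.WellFormed) (h : R M .dead) : ¬ M.Alive := by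
  induction hk : M.rank using Nat.strong_induction_on generalizing M with
  | _ k ih =>
  subst hk
  intro ha
  by_cases hs : M.Stable
  · obtain ⟨γ, hγ⟩ := exists_step_tick hM ha hs
    obtain ⟨γ', hγ', -⟩ := hR.exists_weak h hγ
    obtain ⟨δ, hδ⟩ := stable_dead.exists_step (by simp) hγ'
    exact not_step_dead hδ
  · obtain ⟨γ, hγ⟩ := not_not.1 hs
    obtain ⟨M', hM'⟩ := γ.supp_nonempty
    have h' := hR.rel_of_wTau (hR.1 _ _ h) stable_dead
      (.single (Lift.of_rel (.inl hγ))) M' hM'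
    obtain ⟨ha', hlt⟩ := hγ.alive_and_rank_lt hM ha hM'
    exact ih _ hlt (hγ.wellFormed hM hM') (hR.1 _ _ h') rfl ha'

theorem IsWeakBisimulation.alive_of_rel (hR : IsWeakBisimulation R) {M N : CPS 𝒩}
    (hM : M.WellFormed) (h : R M N) (ha : M.Alive) : N.Alive := by
  by_contra hN
  by_cases hd : N = .dead
  · subst hd
    exact hR.not_alive_of_rel_dead hM h ha
  · obtain ⟨γ, hγ, hc⟩ := hR.exists_weak (hR.1 _ _ h) (step_dead_of_not_alive hN hd)
    obtain ⟨M', hM', h'⟩ := hc.exists_right (Dist.mem_supp_pure.2 rfl)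
    have hI := (weak_tau.1 hγ).forall_supp (I := fun M => M.WellFormed ∧ M.Alive)
      (fun M γ hM h M' hM' => ⟨h.wellFormed hM.1 hM', (h.alive_and_rank_lt hM.1 hM.2 hM').1⟩)
      (fun M' hM' => Dist.mem_supp_pure.1 hM' ▸ ⟨hM, ha⟩) M' hM'
    exact hR.not_alive_of_rel_dead hI.1 (hR.1 _ _ h') hI.2

theorem IsWeakBisimulation.alive_iff (hR : IsWeakBisimulation R) {M N : CPS 𝒩}
    (hM : M.WellFormed) (hN : N.WellFormed) (h : R M N) : M.Alive ↔ N.Alive :=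
  ⟨hR.alive_of_rel hM h, hR.alive_of_rel hN (hR.1 _ _ h)⟩

/-! ### Weak bisimilarity and composition of systems -/

/-- Complementary actions. -/
inductive Comm : Action 𝒩 → Action 𝒩 → Prop
  | outInp (c : 𝒩.Channel) (v : Value 𝒩) : Comm (.out c v) (.inp c v)
  | inpOut (c : 𝒩.Channel) (v : Value 𝒩) : Comm (.inp c v) (.out c v)

theorem Comm.ne_tau {a b : Action 𝒩} (h : Comm a b) : a ≠ .tau ∧ a ≠ .tick ∧ b ≠ .tick := by
  cases h <;> simp

/-- The transitions that the composition `op M k` inherits from a system `M` and a component `k`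
with the transition relation `step`: interleaving, communication, and synchronous passing of
time if no communication is possible. -/
inductive Joint {K : Type u} (step : K → Action 𝒩 → Dist K → Prop) (op : CPS 𝒩 → K → CPS 𝒩)
    (M : CPS 𝒩) (k : K) : Action 𝒩 → Dist (CPS 𝒩) → Prop
  | left {α : Action 𝒩} {δ : Dist (CPS 𝒩)} : α ≠ .tick → Step M α δ →
      Joint step op M k α (δ.map fun M' => op M' k)
  | right {α : Action 𝒩} {ε : Dist K} : α ≠ .tick → step k α ε →
      Joint step op M k α (ε.map (op M))
  | comm {a b : Action 𝒩} {δ : Dist (CPS 𝒩)} {ε : Dist K} : Comm a b → Step M a δ → step k b ε →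
      Joint step op M k .tau (Dist.map₂ op δ ε)
  | tick {δ : Dist (CPS 𝒩)} {ε : Dist K} : Step M .tick δ → step k .tick ε →
      (∀ a b δ' ε', Comm a b → Step M a δ' → ¬ step k b ε') →
      Joint step op M k .tick (Dist.map₂ op δ ε)

/-- An operator composing systems with components, such as disjoint union of systems or parallel
composition with processes: `ok M k` says that `M` and `k` may be composed, and `alive k` that the
invariant of `k`, if it has one, holds. -/
structure IsComposition {K : Type u} (step : K → Action 𝒩 → Dist K → Prop)
    (op : CPS 𝒩 → K → CPS 𝒩) (ok : CPS 𝒩 → K → Prop) (alive : K → Prop) : Prop where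
  wellFormed {M : CPS 𝒩} {k : K} : ok M k → M.WellFormed
  ok_left {M : CPS 𝒩} {k : K} {α : Action 𝒩} {γ : Dist (CPS 𝒩)} : ok M k → Step M α γ →
    ∀ M' ∈ γ.supp, ok M' k
  ok_right {M : CPS 𝒩} {k : K} {α : Action 𝒩} {ε : Dist K} : ok M k → step k α ε →
    ∀ k' ∈ ε.supp, ok M k'
  alive_iff {M : CPS 𝒩} {k : K} : ok M k → ((op M k).Alive ↔ M.Alive ∧ alive k)
  op_dead {k : K} : op .dead k = .dead
  op_ne_dead {M : CPS 𝒩} {k : K} : M ≠ .dead → alive k → op M k ≠ .dead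
  step_iff {M : CPS 𝒩} {k : K} {α : Action 𝒩} {γ : Dist (CPS 𝒩)} :
    ok M k → M.Alive → alive k → (Step (op M k) α γ ↔ Joint step op M k α γ)

namespace IsComposition

variable {K : Type u} {step : K → Action 𝒩 → Dist K → Prop} {op : CPS 𝒩 → K → CPS 𝒩}
  {ok : CPS 𝒩 → K → Prop} {alive : K → Prop} {R : CPS 𝒩 → CPS 𝒩 → Prop}

theorem hatStep_op (h : IsComposition step op ok alive) {M : CPS 𝒩} {k : K} (hok : ok M k)
    (hk : alive k) {α : Action 𝒩} (hα : α ≠ .tick) {δ : Dist (CPS 𝒩)} (hδ : HatStep α M δ) :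
    HatStep α (op M k) (δ.map fun M' => op M' k) := by
  obtain hδ | ⟨rfl, rfl⟩ := hδ
  · by_cases hM : M.Alive
    · exact .inl ((h.step_iff hok hM hk).2 (.left hα hδ))
    · obtain ⟨rfl, rfl⟩ := hδ.eq_of_not_alive hM
      refine .inl ?_
      rw [Dist.map_eq_bind, Dist.pure_bind, h.op_dead]
      refine step_dead_of_not_alive (fun hA => hM ((h.alive_iff hok).1 hA).1)
        (h.op_ne_dead ?_ hk)
      rintro rfl
      exact not_step_dead hδ
  · exact .inr ⟨rfl, Dist.pure_bind _ _⟩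

theorem wTau_op (h : IsComposition step op ok alive) {k : K} (hk : alive k)
    {γ γ' : Dist (CPS 𝒩)} (hγ : WTau γ γ') (hok : ∀ M ∈ γ.supp, ok M k) :
    WTau (γ.map fun M => op M k) (γ'.map fun M => op M k) :=
  hγ.map (I := fun M => ok M k) (fun _ _ hM hδ => h.ok_left hM hδ)
    (fun _ _ hM hδ => h.hatStep_op hM hk (by simp) (.inl hδ)) hok

theorem ok_wTau (h : IsComposition step op ok alive) {k : K}
    {γ γ' : Dist (CPS 𝒩)} (hγ : WTau γ γ') (hok : ∀ M ∈ γ.supp, ok M k) : ∀ M ∈ γ'.supp, ok M k :=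
  hγ.forall_supp (I := fun M => ok M k) (fun _ _ hM hδ => h.ok_left hM hδ) hok

theorem ok_lift (h : IsComposition step op ok alive) {k : K} {α : Action 𝒩}
    {γ γ' : Dist (CPS 𝒩)} (hγ : Lift (HatStep α) γ γ') (hok : ∀ M ∈ γ.supp, ok M k) :
    ∀ M ∈ γ'.supp, ok M k := by
  intro M' hM'
  obtain ⟨M, hM, δ, hδ | ⟨-, rfl⟩, hM'⟩ := hγ.exists_left hM'
  · exact h.ok_left (hok M hM) hδ M' hM'
  · rw [Dist.mem_supp_pure.1 hM']
    exact hok M hM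

theorem weak_op (h : IsComposition step op ok alive) {k : K} (hk : alive k) {α : Action 𝒩}
    (hα : α ≠ .tick) {γ γ' : Dist (CPS 𝒩)} (hγ : Weak α γ γ') (hok : ∀ M ∈ γ.supp, ok M k) :
    Weak α (γ.map fun M => op M k) (γ'.map fun M => op M k) := by
  obtain ⟨γ₁, γ₂, h₁, h₁₂, h₂⟩ := hγ
  have hok₁ := h.ok_wTau h₁ hok
  refine ⟨_, _, h.wTau_op hk h₁ hok, h₁₂.bind_bind fun M hM δ hδ => Lift.of_rel ?_,
    h.wTau_op hk h₂ (h.ok_lift h₁₂ hok₁)⟩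
  exact h.hatStep_op (hok₁ M hM) hk hα hδ

theorem ok_weak (h : IsComposition step op ok alive) {k : K} {α : Action 𝒩}
    {γ γ' : Dist (CPS 𝒩)} (hγ : Weak α γ γ') (hok : ∀ M ∈ γ.supp, ok M k) :
    ∀ M ∈ γ'.supp, ok M k := by
  obtain ⟨γ₁, γ₂, h₁, h₁₂, h₂⟩ := hγ
  exact h.ok_wTau h₂ (h.ok_lift h₁₂ (h.ok_wTau h₁ hok))

/-- The relation that witnesses the congruence property for `op`. Systems whose invariants fail are
related to each other as well, since after the composition with a component whose invariant fails
nothing is left of the behaviour of `R`-related systems. -/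
inductive Closure (op : CPS 𝒩 → K → CPS 𝒩) (ok : CPS 𝒩 → K → Prop) (R : CPS 𝒩 → CPS 𝒩 → Prop) :
    CPS 𝒩 → CPS 𝒩 → Prop
  | notAlive {M N : CPS 𝒩} : ¬ M.Alive → ¬ N.Alive → Closure op ok R M N
  | op {M N : CPS 𝒩} {k : K} : R M N → ok M k → ok N k → Closure op ok R (op M k) (op N k)

theorem closure_symm (hR : IsWeakBisimulation R) {M N : CPS 𝒩} (h : Closure op ok R M N) :
    Closure op ok R N M := by
  cases h with
  | notAlive hM hN => exact .notAlive hN hM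
  | op h hM hN => exact .op (hR.1 _ _ h) hN hM

theorem closure_not_alive {M N : CPS 𝒩} (hM : ¬ M.Alive) (hN : ¬ N.Alive) {α : Action 𝒩}
    {γ : Dist (CPS 𝒩)} (hγ : Step M α γ) :
    ∃ γ', Weak α (Dist.pure N) γ' ∧ Coupled (Closure op ok R) γ γ' := by
  obtain ⟨rfl, rfl⟩ := hγ.eq_of_not_alive hM
  refine ⟨Dist.pure .dead, weak_tau.2 ?_, .pure (.notAlive id id)⟩
  by_cases hd : N = .dead
  · rw [hd]
    exact .refl
  · exact .single (Lift.of_rel (.inl (step_dead_of_not_alive hN hd)))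

/-- After a common step of a system and the component, the system can complete its weak transition
in the composition. If the invariant of the new component fails, then there is no need to. -/
theorem exists_wTau_map₂ (h : IsComposition step op ok alive) {δ γ γ' : Dist (CPS 𝒩)} {ε : Dist K}
    (hγ : WTau γ γ') (hδ : Coupled R δ γ') (hokδ : ∀ k ∈ ε.supp, ∀ M ∈ δ.supp, ok M k)
    (hokγ : ∀ k ∈ ε.supp, ∀ M ∈ γ.supp, ok M k) :
    ∃ γ'', WTau (Dist.map₂ op γ ε) γ'' ∧
      Coupled (Closure op ok R) (Dist.map₂ op δ ε) γ'' := by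
  classical
  have e (η : Dist (CPS 𝒩)) : Dist.map₂ op η ε = ε.bind fun k => η.map fun M => op M k :=
    Dist.bind_comm _ _ _
  rw [e, e]
  refine ⟨ε.bind fun k => if alive k then γ'.map fun M => op M k else γ.map fun M => op M k,
    WTau.bind fun k hk => ?_, Coupled.bind fun k hk => ?_⟩
  · by_cases ha : alive k
    · rw [if_pos ha]
      exact h.wTau_op ha hγ (hokγ k hk)
    · rw [if_neg ha]
      exact .refl
  · by_cases ha : alive k
    · rw [if_pos ha]
      exact hδ.map fun M hM N hN hMN =>
        .op hMN (hokδ k hk M hM) (h.ok_wTau hγ (hokγ k hk) N hN)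
    · rw [if_neg ha]
      refine Coupled.of_forall fun M hM N hN => ?_
      obtain ⟨M, hM', rfl⟩ := Dist.mem_supp_map.1 hM
      obtain ⟨N, hN', rfl⟩ := Dist.mem_supp_map.1 hN
      exact .notAlive (fun hA => ha ((h.alive_iff (hokδ k hk M hM')).1 hA).2)
        fun hA => ha ((h.alive_iff (hokγ k hk N hN')).1 hA).2

/-- The simulation of a step `α` of a composition that consists of a step `a` of the system and a
step `b` of the component. -/
theorem closure_sync (h : IsComposition step op ok alive) (hR : IsWeakBisimulation R)
    {M N : CPS 𝒩} {k : K} (hMN : R M N) (hM : ok M k) (hN : ok N k) (hk : alive k)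
    {a b α : Action 𝒩} (ha : a ≠ .tau) {δ : Dist (CPS 𝒩)} {ε : Dist K} (hδ : Step M a δ)
    (hε : step k b ε)
    (hsync : ∀ γ, WTau (Dist.pure N) γ → ∀ N' ∈ γ.supp, ∀ δ', Step N' a δ' →
      Joint step op N' k α (Dist.map₂ op δ' ε)) :
    ∃ γ', Weak α (Dist.pure (op N k)) γ' ∧
      Coupled (Closure op ok R) (Dist.map₂ op δ ε) γ' := by
  obtain ⟨γ', ⟨γ₁, γ₂, h₁, h₁₂, h₂⟩, hc⟩ := hR.exists_weak hMN hδ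
  have hok : ∀ N' ∈ (Dist.pure N).supp, ok N' k := fun N' hN' => Dist.mem_supp_pure.1 hN' ▸ hN
  have hok₁ := h.ok_wTau h₁ hok
  have hok₂ := h.ok_lift h₁₂ hok₁
  obtain ⟨γ'', hγ'', hc'⟩ := h.exists_wTau_map₂ h₂ hc (ε := ε)
    (fun k' hk' M' hM' => h.ok_right (h.ok_left hM hδ M' hM') hε k' hk')
    (fun k' hk' N' hN' => h.ok_right (hok₂ N' hN') hε k' hk')
  refine ⟨γ'', ⟨γ₁.map fun N' => op N' k, _, ?_, ?_, hγ''⟩, hc'⟩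
  · have := h.wTau_op hk h₁ hok
    rwa [Dist.map_eq_bind, Dist.pure_bind] at this
  · refine h₁₂.bind_bind fun N' hN' δ' hδ' => Lift.of_rel (.inl ?_)
    have hδ' : Step N' a δ' := hδ'.resolve_right fun h => ha h.1
    exact (h.step_iff (hok₁ N' hN') (hδ'.alive ha) hk).2 (hsync γ₁ h₁ N' hN' δ' hδ')

theorem isWeakBisimulation_closure (h : IsComposition step op ok alive)
    (hR : IsWeakBisimulation R) : IsWeakBisimulation (Closure op ok R) := by
  refine isWeakBisimulation_iff.2 ⟨fun _ _ => closure_symm hR, ?_⟩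
  rintro _ _ (⟨hM, hN⟩ | @⟨M, N, k, hMN, hM, hN⟩) α γ hγ
  · exact closure_not_alive hM hN hγ
  have hiff := hR.alive_iff (h.wellFormed hM) (h.wellFormed hN) hMN
  by_cases ha : M.Alive ∧ alive k
  swap
  · refine closure_not_alive (fun hA => ha ((h.alive_iff hM).1 hA)) (fun hA => ha ?_) hγ
    rw [hiff]
    exact (h.alive_iff hN).1 hA
  obtain ⟨haM, hk⟩ := ha
  have hok : ∀ N' ∈ (Dist.pure N).supp, ok N' k := fun N' hN' => Dist.mem_supp_pure.1 hN' ▸ hN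
  obtain ⟨hα, hδ⟩ | ⟨hα, hε⟩ | ⟨hab, hδ, hε⟩ | ⟨hδ, hε, hno⟩ := (h.step_iff hM haM hk).1 hγ
  · obtain ⟨γ', hγ', hc⟩ := hR.exists_weak hMN hδ
    refine ⟨γ'.map fun N' => op N' k, ?_, hc.map fun M' hM' N' hN' h' =>
      .op h' (h.ok_left hM hδ M' hM') (h.ok_weak hγ' hok N' hN')⟩
    have := h.weak_op hk hα hγ' hok
    rwa [Dist.map_eq_bind, Dist.pure_bind] at this
  · rename_i ε
    refine ⟨ε.map (op N), ⟨_, _, .refl,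
      Lift.of_rel (.inl ((h.step_iff hN (hiff.1 haM) hk).2 (.right hα hε))), .refl⟩,
      Coupled.bind fun k' hk' => .pure ?_⟩
    exact .op hMN (h.ok_right hM hε k' hk') (h.ok_right hN hε k' hk')
  · exact h.closure_sync hR hMN hM hN hk hab.ne_tau.1 hδ hε fun _ _ _ _ _ hδ' =>
      .comm hab hδ' hε
  · refine h.closure_sync hR hMN hM hN hk (by simp) hδ hε fun γ₁ h₁ N' hN' _ hδ' =>
      .tick hδ' hε fun a b δ₁ ε₁ hab hδ₁ => ?_
    -- `M` is stable, so that it can perform every visible action that `N'` can perform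
    have hMN' := hR.rel_of_wTau hMN hδ.stable h₁ N' hN'
    obtain ⟨γ', hγ', -⟩ := hR.exists_weak (hR.1 _ _ hMN') hδ₁
    obtain ⟨δ₂, hδ₂⟩ := hδ.stable.exists_step hab.ne_tau.1 hγ'
    exact hno a b δ₂ ε₁ hab hδ₂

theorem bisimilar (h : IsComposition step op ok alive) {M N : CPS 𝒩} {k : K} (hM : ok M k)
    (hN : ok N k) (hMN : Bisimilar M N) : Bisimilar (op M k) (op N k) := by
  obtain ⟨R, hR, hMN⟩ := hMN
  exact ⟨_, h.isWeakBisimulation_closure hR, .op hMN hM hN⟩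

end IsComposition

/-! ### Parallel composition of processes -/

theorem pStep_par_iff {P Q : ClosedProc 𝒩} {l : Label 𝒩} {π : Dist (ClosedProc 𝒩)} :
    PStep (.par P Q) l π ↔
      (∃ π₁, PStep P l π₁ ∧ π = Dist.map₂ .par π₁ (Dist.pure Q)) ∨
      (∃ π₂, PStep Q l π₂ ∧ π = Dist.map₂ .par (Dist.pure P) π₂) ∨
      (l = .tau ∧ ∃ c v π₁ π₂, (PStep P (.out c v) π₁ ∧ PStep Q (.inp c v) π₂ ∨
        PStep P (.inp c v) π₁ ∧ PStep Q (.out c v) π₂) ∧ π = Dist.map₂ .par π₁ π₂) := by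
  constructor
  · intro h
    cases h with
    | comL h₁ h₂ => exact .inr (.inr ⟨rfl, _, _, _, _, .inl ⟨h₁, h₂⟩, rfl⟩)
    | comR h₁ h₂ => exact .inr (.inr ⟨rfl, _, _, _, _, .inr ⟨h₁, h₂⟩, rfl⟩)
    | parL h => exact .inl ⟨_, h, rfl⟩
    | parR h => exact .inr (.inl ⟨_, h, rfl⟩)
  · rintro (⟨_, h, rfl⟩ | ⟨_, h, rfl⟩ | ⟨rfl, _, _, _, _, ⟨h₁, h₂⟩ | ⟨h₁, h₂⟩, rfl⟩)
    · exact .parL h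
    · exact .parR h
    · exact .comL h₁ h₂
    · exact .comR h₁ h₂

theorem pTick_par_iff {P Q : ClosedProc 𝒩} {π : Dist (ClosedProc 𝒩)} :
    PTick (.par P Q) π ↔ (¬ ∃ π, PStep (.par P Q) .tau π) ∧
      ∃ π₁ π₂, PTick P π₁ ∧ PTick Q π₂ ∧ π = Dist.map₂ .par π₁ π₂ := by
  constructor
  · intro h
    cases h with | par h₁ h₂ h => exact ⟨h, _, _, h₁, h₂, rfl⟩
  · rintro ⟨h, _, _, h₁, h₂, rfl⟩
    exact .par h₁ h₂ h

section

variable {X : Set 𝒩.StateVar} {S : Set 𝒩.Sensor} {A : Set 𝒩.Actuator} {E : PhysEnv X S A}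
  {st : PhysState X S A} {P : ClosedProc 𝒩} {c : 𝒩.Channel} {v : Value 𝒩} {γ : Dist (CPS 𝒩)}

theorem step_out_iff : Step (.mk E st P) (.out c v) γ ↔
    st.stateFun ∈ E.inv ∧ ∃ π, PStep P (.out c v) π ∧ γ = π.map (CPS.mk E st) := by
  constructor
  · intro h
    cases h with | out h hinv => exact ⟨hinv, _, h, conf_pure ..⟩
  · rintro ⟨hinv, π, h, rfl⟩
    exact (step_mk_iff hinv (by simp)).2 ⟨_, _, _, .out c v, h, rfl⟩

theorem step_inp_iff : Step (.mk E st P) (.inp c v) γ ↔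
    st.stateFun ∈ E.inv ∧ ∃ π, PStep P (.inp c v) π ∧ γ = π.map (CPS.mk E st) := by
  constructor
  · intro h
    cases h with | inp h hinv => exact ⟨hinv, _, h, conf_pure ..⟩
  · rintro ⟨hinv, π, h, rfl⟩
    exact (step_mk_iff hinv (by simp)).2 ⟨_, _, _, .inp c v, h, rfl⟩

end

/-! ### Composition of systems with pure-logical processes -/

/-- The transitions of a process that are actions of systems. -/
def procStep (P : ClosedProc 𝒩) : Action 𝒩 → Dist (ClosedProc 𝒩) → Prop
  | .tau => PStep P .tau
  | .tick => PTick P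
  | .out c v => PStep P (.out c v)
  | .inp c v => PStep P (.inp c v)

theorem pureLogical_iff {P : ClosedProc 𝒩} : P.PureLogical ↔ P.Within ∅ ∅ := by
  simp [Proc.PureLogical, Proc.Within]

theorem procStep.within {S : Set 𝒩.Sensor} {A : Set 𝒩.Actuator} {P : ClosedProc 𝒩}
    {α : Action 𝒩} {π : Dist (ClosedProc 𝒩)} (h : procStep P α π) (hP : P.Within S A) :
    ∀ P' ∈ π.supp, P'.Within S A := by
  cases α with
  | tick => exact PTick.within h hP
  | _ => exact (PStep.within h hP).2

theorem map_par_left {X : Set 𝒩.StateVar} {S : Set 𝒩.Sensor} {A : Set 𝒩.Actuator}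
    (E : PhysEnv X S A) (st : PhysState X S A) (π : Dist (ClosedProc 𝒩)) (Q : ClosedProc 𝒩) :
    (Dist.map₂ Proc.par π (Dist.pure Q)).map (CPS.mk E st) =
      (π.map (CPS.mk E st)).map fun M => M.par Q := by
  simp [Dist.map_eq_bind, Dist.map₂_eq_bind, CPS.par]

theorem map_par_right {X : Set 𝒩.StateVar} {S : Set 𝒩.Sensor} {A : Set 𝒩.Actuator}
    (E : PhysEnv X S A) (st : PhysState X S A) (P : ClosedProc 𝒩) (π : Dist (ClosedProc 𝒩)) :
    (Dist.map₂ Proc.par (Dist.pure P) π).map (CPS.mk E st) =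
      π.map (CPS.mk E st P).par := by
  simp [Dist.map_eq_bind, Dist.map₂_eq_bind, CPS.par]

theorem map_par_both {X : Set 𝒩.StateVar} {S : Set 𝒩.Sensor} {A : Set 𝒩.Actuator}
    (E : PhysEnv X S A) (st : PhysState X S A) (π₁ π₂ : Dist (ClosedProc 𝒩)) :
    (Dist.map₂ Proc.par π₁ π₂).map (CPS.mk E st) =
      Dist.map₂ CPS.par (π₁.map (CPS.mk E st)) π₂ := by
  simp [Dist.map_eq_bind, Dist.map₂_eq_bind, CPS.par]

theorem conf_par {X : Set 𝒩.StateVar} {S : Set 𝒩.Sensor} {A : Set 𝒩.Actuator}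
    (E : PhysEnv X S A) (σ : Dist (PhysState X S A)) (π₁ π₂ : Dist (ClosedProc 𝒩)) :
    conf E σ (Dist.map₂ Proc.par π₁ π₂) = Dist.map₂ CPS.par (conf E σ π₁) π₂ := by
  simp [conf, Dist.map₂_eq_bind, CPS.par]

theorem step_par_iff {M : CPS 𝒩} {Q : ClosedProc 𝒩} (hQ : Q.Within ∅ ∅) (hM : M.Alive)
    {α : Action 𝒩} (hα : α ≠ .tick) {γ : Dist (CPS 𝒩)} :
    Step (M.par Q) α γ ↔ Joint procStep CPS.par M Q α γ := by
  cases M with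
  | dead => exact hM.elim
  | mk E st P =>
  rw [CPS.par, step_mk_iff hM hα]
  constructor
  · rintro ⟨l, st', π, hp, hπ, rfl⟩
    obtain ⟨π₁, h, rfl⟩ | ⟨π₂, h, rfl⟩ | ⟨rfl, c, v, π₁, π₂, h, rfl⟩ := pStep_par_iff.1 hπ
    · rw [map_par_left]
      exact .left hα ((step_mk_iff hM hα).2 ⟨l, st', π₁, hp, h, rfl⟩)
    · have hl := (h.within hQ).1
      cases hp with
      | tau | out | inp =>
        rw [map_par_right]
        exact .right hα h
      | read | write => exact hl.elim
    · cases hp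
      rw [map_par_both]
      obtain ⟨h₁, h₂⟩ | ⟨h₁, h₂⟩ := h
      · exact .comm (.outInp c v) (step_out_iff.2 ⟨hM, _, h₁, rfl⟩) h₂
      · exact .comm (.inpOut c v) (step_inp_iff.2 ⟨hM, _, h₁, rfl⟩) h₂
  · rintro (⟨_, hδ⟩ | ⟨_, h⟩ | ⟨⟨c, v⟩ | ⟨c, v⟩, hδ, h₂⟩ | _)
    · obtain ⟨l, st', π₁, hp, h, rfl⟩ := (step_mk_iff hM hα).1 hδ
      exact ⟨l, st', _, hp, .parL h, (map_par_left ..).symm⟩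
    · cases α with
      | tau => exact ⟨_, _, _, .tau, .parR h, (map_par_right ..).symm⟩
      | tick => exact absurd rfl hα
      | out c v => exact ⟨_, _, _, .out c v, .parR h, (map_par_right ..).symm⟩
      | inp c v => exact ⟨_, _, _, .inp c v, .parR h, (map_par_right ..).symm⟩
    · obtain ⟨-, π₁, h₁, rfl⟩ := step_out_iff.1 hδ
      exact ⟨_, _, _, .tau, .comL h₁ h₂, (map_par_both ..).symm⟩
    · obtain ⟨-, π₁, h₁, rfl⟩ := step_inp_iff.1 hδ
      exact ⟨_, _, _, .tau, .comR h₁ h₂, (map_par_both ..).symm⟩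
    · exact absurd rfl hα

theorem step_tick_par_iff {M : CPS 𝒩} {Q : ClosedProc 𝒩} (hQ : Q.Within ∅ ∅) (hM : M.Alive)
    {γ : Dist (CPS 𝒩)} :
    Step (M.par Q) .tick γ ↔ Joint procStep CPS.par M Q .tick γ := by
  have hτ {γ : Dist (CPS 𝒩)} := step_par_iff hQ hM (α := .tau) (by simp) (γ := γ)
  cases M with
  | dead => exact hM.elim
  | mk E st P =>
  constructor
  · intro h
    obtain ⟨-, hs, π, hπ, rfl⟩ := step_tick_iff.1 h
    obtain ⟨hno, π₁, π₂, h₁, h₂, rfl⟩ := pTick_par_iff.1 hπ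
    rw [conf_par]
    refine .tick (step_tick_iff.2 ⟨hM, fun ⟨_, h⟩ => hs ⟨_, hτ.2 (.left (by simp) h)⟩, _, h₁, rfl⟩)
      h₂ fun a b δ ε hab hδ hε => hs ⟨_, hτ.2 (.comm hab hδ hε)⟩
  · rintro (⟨h, _⟩ | ⟨h, _⟩ | _ | ⟨hδ, h₂, hno⟩)
    · exact absurd rfl h
    · exact absurd rfl h
    obtain ⟨-, hs, π₁, h₁, rfl⟩ := step_tick_iff.1 hδ
    have hs' : (CPS.mk E st (.par P Q)).Stable := by
      rintro ⟨_, hγ⟩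
      obtain ⟨_, h⟩ | ⟨_, h⟩ | ⟨hab, h, h'⟩ | _ := hτ.1 hγ
      · exact hs ⟨_, h⟩
      · exact PTick.not_tau h₂ ⟨_, h⟩
      · exact hno _ _ _ _ hab h h'
    rw [← conf_par]
    refine step_tick_iff.2 ⟨hM, hs', _, pTick_par_iff.2 ⟨?_, _, _, h₁, h₂, rfl⟩, rfl⟩
    rintro ⟨π, h⟩
    exact hs' ⟨_, (step_mk_iff hM (by simp)).2 ⟨_, _, _, .tau, h, rfl⟩⟩

theorem isComposition_par : IsComposition (𝒩 := 𝒩) procStep CPS.par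
    (fun M Q => M.WellFormed ∧ Q.Within ∅ ∅) fun _ => True where
  wellFormed h := h.1
  ok_left h hδ _ hM' := ⟨hδ.wellFormed h.1 hM', h.2⟩
  ok_right h hε _ hQ' := ⟨h.1, hε.within h.2 _ hQ'⟩
  alive_iff {M Q} _ := by cases M <;> simp [CPS.par, CPS.Alive]
  op_dead := rfl
  op_ne_dead {M Q} hM _ := by
    cases M with
    | dead => exact absurd rfl hM
    | mk => simp [CPS.par]
  step_iff {M Q α γ} h hM _ := by
    by_cases hα : α = .tick
    · subst hα
      exact step_tick_par_iff h.2 hM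
    · exact step_par_iff h.2 hM hα

/-! ### Disjoint union of physical components -/

section

variable {T : Type u} {X₁ X₂ : Set T}

@[simp]
theorem fstPart_union (ξ₁ : X₁ → ℝ) (ξ₂ : X₂ → ℝ) : fstPart (union ξ₁ ξ₂) = ξ₁ := by
  ext n
  simp [fstPart, union]

theorem sndPart_union (h : Disjoint X₁ X₂) (ξ₁ : X₁ → ℝ) (ξ₂ : X₂ → ℝ) :
    sndPart (union ξ₁ ξ₂) = ξ₂ := by
  ext n
  simp [sndPart, union, Set.disjoint_right.1 h n.2]

open Classical in
theorem update_union_left (ξ₁ : X₁ → ℝ) (ξ₂ : X₂ → ℝ) (a : X₁) (r : ℝ) :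
    Function.update (union ξ₁ ξ₂) ⟨a, .inl a.2⟩ r = union (Function.update ξ₁ a r) ξ₂ := by
  ext n
  by_cases h : n = ⟨a, .inl a.2⟩
  · subst h
    simp [union]
  · rw [Function.update_of_ne h]
    by_cases hn : (n : T) ∈ X₁
    · have : (⟨n, hn⟩ : X₁) ≠ a := fun h' =>
        h (Subtype.ext (congrArg (fun x : X₁ => (x : T)) h'))
      simp [union, hn, this]
    · simp [union, hn]

open Classical in
theorem update_union_right (h : Disjoint X₁ X₂) (ξ₁ : X₁ → ℝ) (ξ₂ : X₂ → ℝ) (a : X₂) (r : ℝ) :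
    Function.update (union ξ₁ ξ₂) ⟨a, .inr a.2⟩ r = union ξ₁ (Function.update ξ₂ a r) := by
  ext n
  by_cases hna : n = ⟨a, .inr a.2⟩
  · subst hna
    simp [union, Set.disjoint_right.1 h a.2]
  · rw [Function.update_of_ne hna]
    by_cases hn : (n : T) ∈ X₁
    · simp [union, hn]
    · have : (⟨n, n.2.resolve_left hn⟩ : X₂) ≠ a :=
        fun h' => hna (Subtype.ext (congrArg (fun x : X₂ => (x : T)) h'))
      simp [union, hn, this]

end

section

variable {X₁ X₂ : Set 𝒩.StateVar} {S₁ S₂ : Set 𝒩.Sensor} {A₁ A₂ : Set 𝒩.Actuator}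

theorem next_union (hX : Disjoint X₁ X₂) (hA : Disjoint A₁ A₂) (E₁ : PhysEnv X₁ S₁ A₁)
    (E₂ : PhysEnv X₂ S₂ A₂) (st₁ : PhysState X₁ S₁ A₁) (st₂ : PhysState X₂ S₂ A₂) :
    (E₁.union E₂).next (st₁.union st₂) =
      Dist.map₂ PhysState.union (E₁.next st₁) (E₂.next st₂) := by
  simp only [PhysEnv.next, PhysEnv.union, PhysState.union, Dist.map₂_eq_bind, Dist.map_eq_bind,
    Dist.bind_assoc, Dist.pure_bind, fstPart_union, sndPart_union hX, sndPart_union hA]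
  exact Dist.bind_congr fun x₁ _ => Dist.bind_comm _ _ _

theorem mk_union_mk (E₁ : PhysEnv X₁ S₁ A₁) (E₂ : PhysEnv X₂ S₂ A₂) (st₁ : PhysState X₁ S₁ A₁)
    (st₂ : PhysState X₂ S₂ A₂) (P₁ P₂ : ClosedProc 𝒩) :
    (CPS.mk E₁ st₁ P₁).union (.mk E₂ st₂ P₂) =
      .mk (E₁.union E₂) (st₁.union st₂) (.par P₁ P₂) := rfl

theorem conf_union (E₁ : PhysEnv X₁ S₁ A₁) (E₂ : PhysEnv X₂ S₂ A₂)
    (σ₁ : Dist (PhysState X₁ S₁ A₁)) (σ₂ : Dist (PhysState X₂ S₂ A₂))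
    (π₁ π₂ : Dist (ClosedProc 𝒩)) :
    conf (E₁.union E₂) (Dist.map₂ PhysState.union σ₁ σ₂) (Dist.map₂ .par π₁ π₂) =
      Dist.map₂ CPS.union (conf E₁ σ₁ π₁) (conf E₂ σ₂ π₂) := by
  simp only [conf, Dist.map₂_eq_bind, Dist.bind_assoc, Dist.pure_bind, mk_union_mk]
  exact Dist.bind_congr fun x₁ _ => Dist.bind_comm _ _ _

theorem map_union_left (E₁ : PhysEnv X₁ S₁ A₁) (E₂ : PhysEnv X₂ S₂ A₂)
    (st₁ : PhysState X₁ S₁ A₁) (st₂ : PhysState X₂ S₂ A₂) (π : Dist (ClosedProc 𝒩))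
    (Q : ClosedProc 𝒩) :
    (Dist.map₂ Proc.par π (Dist.pure Q)).map (CPS.mk (E₁.union E₂) (st₁.union st₂)) =
      (π.map (CPS.mk E₁ st₁)).map fun M => M.union (.mk E₂ st₂ Q) := by
  simp [Dist.map_eq_bind, Dist.map₂_eq_bind, mk_union_mk]

theorem map_union_right (E₁ : PhysEnv X₁ S₁ A₁) (E₂ : PhysEnv X₂ S₂ A₂)
    (st₁ : PhysState X₁ S₁ A₁) (st₂ : PhysState X₂ S₂ A₂) (P : ClosedProc 𝒩)
    (π : Dist (ClosedProc 𝒩)) :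
    (Dist.map₂ Proc.par (Dist.pure P) π).map (CPS.mk (E₁.union E₂) (st₁.union st₂)) =
      (π.map (CPS.mk E₂ st₂)).map (CPS.mk E₁ st₁ P).union := by
  simp [Dist.map_eq_bind, Dist.map₂_eq_bind, mk_union_mk]

theorem map_union_both (E₁ : PhysEnv X₁ S₁ A₁) (E₂ : PhysEnv X₂ S₂ A₂)
    (st₁ : PhysState X₁ S₁ A₁) (st₂ : PhysState X₂ S₂ A₂) (π₁ π₂ : Dist (ClosedProc 𝒩)) :
    (Dist.map₂ Proc.par π₁ π₂).map (CPS.mk (E₁.union E₂) (st₁.union st₂)) =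
      Dist.map₂ CPS.union (π₁.map (CPS.mk E₁ st₁)) (π₂.map (CPS.mk E₂ st₂)) := by
  simp [Dist.map_eq_bind, Dist.map₂_eq_bind, mk_union_mk]

variable {st₁ : PhysState X₁ S₁ A₁} {st₂ : PhysState X₂ S₂ A₂} {l : Label 𝒩} {α : Action 𝒩}

theorem setActuator_union_left (a : A₁) (r : ℝ) :
    (st₁.union st₂).setActuator ⟨a, .inl a.2⟩ r = (st₁.setActuator a r).union st₂ := by
  simp only [PhysState.setActuator, PhysState.union, update_union_left]

theorem setActuator_union_right (hA : Disjoint A₁ A₂) (a : A₂) (r : ℝ) :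
    (st₁.union st₂).setActuator ⟨a, .inr a.2⟩ r = st₁.union (st₂.setActuator a r) := by
  simp only [PhysState.setActuator, PhysState.union, update_union_right hA]

theorem sensorFun_union_left (s : S₁) :
    (st₁.union st₂).sensorFun ⟨s, .inl s.2⟩ = st₁.sensorFun s :=
  congrFun (fstPart_union st₁.sensorFun st₂.sensorFun) s

theorem sensorFun_union_right (hS : Disjoint S₁ S₂) (s : S₂) :
    (st₁.union st₂).sensorFun ⟨s, .inr s.2⟩ = st₂.sensorFun s :=
  congrFun (sndPart_union hS st₁.sensorFun st₂.sensorFun) s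

theorem perform_union_left {st : PhysState (X₁ ∪ X₂) (S₁ ∪ S₂) (A₁ ∪ A₂)}
    (hl : l.Within S₁ A₁) :
    Perform (st₁.union st₂) l α st ↔ ∃ st₁', Perform st₁ l α st₁' ∧ st = st₁'.union st₂ := by
  constructor
  · intro h
    cases h with
    | tau => exact ⟨_, .tau, rfl⟩
    | out => exact ⟨_, .out .., rfl⟩
    | inp => exact ⟨_, .inp .., rfl⟩
    | read s =>
      have hs : (s : 𝒩.Sensor) ∈ S₁ := hl
      refine ⟨st₁, ?_, rfl⟩
      rw [show (st₁.union st₂).sensorFun s = _ from sensorFun_union_left (⟨s, hs⟩ : S₁)]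
      exact .read (⟨s, hs⟩ : S₁)
    | write a r =>
      have ha : (a : 𝒩.Actuator) ∈ A₁ := hl
      exact ⟨_, .write (⟨a, ha⟩ : A₁) r, setActuator_union_left (⟨a, ha⟩ : A₁) r⟩
  · rintro ⟨st₁', h, rfl⟩
    cases h with
    | tau => exact .tau
    | out => exact .out ..
    | inp => exact .inp ..
    | read s =>
      rw [← sensorFun_union_left (st₂ := st₂) s]
      exact .read (⟨s, .inl s.2⟩ : ↥(S₁ ∪ S₂))
    | write a r =>
      rw [← setActuator_union_left]
      exact .write (⟨a, .inl a.2⟩ : ↥(A₁ ∪ A₂)) r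

theorem perform_union_right {st : PhysState (X₁ ∪ X₂) (S₁ ∪ S₂) (A₁ ∪ A₂)}
    (hS : Disjoint S₁ S₂) (hA : Disjoint A₁ A₂) (hl : l.Within S₂ A₂) :
    Perform (st₁.union st₂) l α st ↔ ∃ st₂', Perform st₂ l α st₂' ∧ st = st₁.union st₂' := by
  constructor
  · intro h
    cases h with
    | tau => exact ⟨_, .tau, rfl⟩
    | out => exact ⟨_, .out .., rfl⟩
    | inp => exact ⟨_, .inp .., rfl⟩
    | read s =>
      have hs : (s : 𝒩.Sensor) ∈ S₂ := hl
      refine ⟨st₂, ?_, rfl⟩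
      rw [show (st₁.union st₂).sensorFun s = _ from sensorFun_union_right hS (⟨s, hs⟩ : S₂)]
      exact .read (⟨s, hs⟩ : S₂)
    | write a r =>
      have ha : (a : 𝒩.Actuator) ∈ A₂ := hl
      exact ⟨_, .write (⟨a, ha⟩ : A₂) r, setActuator_union_right hA (⟨a, ha⟩ : A₂) r⟩
  · rintro ⟨st₁', h, rfl⟩
    cases h with
    | tau => exact .tau
    | out => exact .out ..
    | inp => exact .inp ..
    | read s =>
      rw [← sensorFun_union_right (st₁ := st₁) hS s]
      exact .read (⟨s, .inr s.2⟩ : ↥(S₁ ∪ S₂))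
    | write a r =>
      rw [← setActuator_union_right hA]
      exact .write (⟨a, .inr a.2⟩ : ↥(A₁ ∪ A₂)) r

end

/-! ### Disjoint union of systems -/

theorem alive_union_iff {M O : CPS 𝒩} (h : M.PhysDisjoint O) :
    (M.union O).Alive ↔ M.Alive ∧ O.Alive := by
  cases M <;> cases O <;> try simp [CPS.union, CPS.Alive]
  simp [PhysEnv.union, PhysState.union, sndPart_union h.1]

theorem step_union_iff {M O : CPS 𝒩} (hMw : M.Within) (hOw : O.Within) (hd : M.PhysDisjoint O)
    (hM : M.Alive) (hO : O.Alive) {α : Action 𝒩} (hα : α ≠ .tick) {γ : Dist (CPS 𝒩)} :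
    Step (M.union O) α γ ↔ Joint Step CPS.union M O α γ := by
  have hinv := (alive_union_iff hd).2 ⟨hM, hO⟩
  cases M with
  | dead => exact hM.elim
  | mk E₁ st₁ P =>
  cases O with
  | dead => exact hO.elim
  | mk E₂ st₂ Q =>
  obtain ⟨-, hS, hA⟩ := hd
  rw [mk_union_mk] at hinv ⊢
  rw [step_mk_iff hinv hα]
  constructor
  · rintro ⟨l, st', π, hp, hπ, rfl⟩
    obtain ⟨π₁, h, rfl⟩ | ⟨π₂, h, rfl⟩ | ⟨rfl, c, v, π₁, π₂, h, rfl⟩ := pStep_par_iff.1 hπ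
    · obtain ⟨st₁', hp', rfl⟩ := (perform_union_left (h.within hMw).1).1 hp
      rw [map_union_left]
      exact .left hα ((step_mk_iff hM hα).2 ⟨l, st₁', π₁, hp', h, rfl⟩)
    · obtain ⟨st₂', hp', rfl⟩ := (perform_union_right hS hA (h.within hOw).1).1 hp
      rw [map_union_right]
      exact .right hα ((step_mk_iff hO hα).2 ⟨l, st₂', π₂, hp', h, rfl⟩)
    · cases hp
      rw [map_union_both]
      obtain ⟨h₁, h₂⟩ | ⟨h₁, h₂⟩ := h
      · exact .comm (.outInp c v) (step_out_iff.2 ⟨hM, _, h₁, rfl⟩)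
          (step_inp_iff.2 ⟨hO, _, h₂, rfl⟩)
      · exact .comm (.inpOut c v) (step_inp_iff.2 ⟨hM, _, h₁, rfl⟩)
          (step_out_iff.2 ⟨hO, _, h₂, rfl⟩)
  · rintro (⟨_, hδ⟩ | ⟨_, hε⟩ | ⟨⟨c, v⟩ | ⟨c, v⟩, hδ, hε⟩ | _)
    · obtain ⟨l, st₁', π₁, hp, h, rfl⟩ := (step_mk_iff hM hα).1 hδ
      exact ⟨l, _, _, (perform_union_left (h.within hMw).1).2 ⟨_, hp, rfl⟩, .parL h,
        (map_union_left ..).symm⟩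
    · obtain ⟨l, st₂', π₂, hp, h, rfl⟩ := (step_mk_iff hO hα).1 hε
      exact ⟨l, _, _, (perform_union_right hS hA (h.within hOw).1).2 ⟨_, hp, rfl⟩, .parR h,
        (map_union_right ..).symm⟩
    · obtain ⟨-, π₁, h₁, rfl⟩ := step_out_iff.1 hδ
      obtain ⟨-, π₂, h₂, rfl⟩ := step_inp_iff.1 hε
      exact ⟨_, _, _, .tau, .comL h₁ h₂, (map_union_both ..).symm⟩
    · obtain ⟨-, π₁, h₁, rfl⟩ := step_inp_iff.1 hδ
      obtain ⟨-, π₂, h₂, rfl⟩ := step_out_iff.1 hε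
      exact ⟨_, _, _, .tau, .comR h₁ h₂, (map_union_both ..).symm⟩
    · exact absurd rfl hα

theorem step_tick_union_iff {M O : CPS 𝒩} (hMw : M.Within) (hOw : O.Within)
    (hd : M.PhysDisjoint O) (hM : M.Alive) (hO : O.Alive) {γ : Dist (CPS 𝒩)} :
    Step (M.union O) .tick γ ↔ Joint Step CPS.union M O .tick γ := by
  have hτ {γ : Dist (CPS 𝒩)} :=
    step_union_iff hMw hOw hd hM hO (α := .tau) (by simp) (γ := γ)
  have hinv := (alive_union_iff hd).2 ⟨hM, hO⟩
  cases M with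
  | dead => exact hM.elim
  | mk E₁ st₁ P =>
  cases O with
  | dead => exact hO.elim
  | mk E₂ st₂ Q =>
  obtain ⟨hX, -, hA⟩ := hd
  rw [mk_union_mk] at *
  constructor
  · intro h
    obtain ⟨-, hs, π, hπ, rfl⟩ := step_tick_iff.1 h
    obtain ⟨hno, π₁, π₂, h₁, h₂, rfl⟩ := pTick_par_iff.1 hπ
    rw [next_union hX hA, conf_union]
    exact .tick
      (step_tick_iff.2 ⟨hM, fun ⟨_, h⟩ => hs ⟨_, hτ.2 (.left (by simp) h)⟩, _, h₁, rfl⟩)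
      (step_tick_iff.2 ⟨hO, fun ⟨_, h⟩ => hs ⟨_, hτ.2 (.right (by simp) h)⟩, _, h₂, rfl⟩)
      fun a b δ ε hab hδ hε => hs ⟨_, hτ.2 (.comm hab hδ hε)⟩
  · rintro (⟨h, _⟩ | ⟨h, _⟩ | _ | ⟨hδ, hε, hno⟩)
    · exact absurd rfl h
    · exact absurd rfl h
    obtain ⟨-, hs₁, π₁, h₁, rfl⟩ := step_tick_iff.1 hδ
    obtain ⟨-, hs₂, π₂, h₂, rfl⟩ := step_tick_iff.1 hε
    have hs : (CPS.mk (E₁.union E₂) (st₁.union st₂) (.par P Q)).Stable := by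
      rintro ⟨_, hγ⟩
      obtain ⟨_, h⟩ | ⟨_, h⟩ | ⟨hab, h, h'⟩ | _ := hτ.1 hγ
      · exact hs₁ ⟨_, h⟩
      · exact hs₂ ⟨_, h⟩
      · exact hno _ _ _ _ hab h h'
    rw [← conf_union, ← next_union hX hA]
    refine step_tick_iff.2 ⟨hinv, hs, _, pTick_par_iff.2 ⟨?_, _, _, h₁, h₂, rfl⟩, rfl⟩
    rintro ⟨π, h⟩
    exact hs ⟨_, (step_mk_iff hinv (by simp)).2 ⟨_, _, _, .tau, h, rfl⟩⟩

theorem isComposition_union : IsComposition (𝒩 := 𝒩) Step CPS.union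
    (fun M O => M.WellFormed ∧ O.Within ∧ M.PhysDisjoint O) CPS.Alive where
  wellFormed h := h.1
  ok_left h hδ _ hM' := ⟨hδ.wellFormed h.1 hM', h.2.1, hδ.physDisjoint h.2.2 hM'⟩
  ok_right h hε _ hO' :=
    ⟨h.1, hε.within h.2.1 hO', (hε.physDisjoint h.2.2.symm hO').symm⟩
  alive_iff h := alive_union_iff h.2.2
  op_dead := rfl
  op_ne_dead {M O} hM hO := by
    cases M with
    | dead => exact absurd rfl hM
    | mk =>
      cases O with
      | dead => exact hO.elim
      | mk => simp [CPS.union]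
  step_iff {M O α γ} h hM hO := by
    by_cases hα : α = .tick
    · subst hα
      exact step_tick_union_iff h.1.within h.2.1 h.2.2 hM hO
    · exact step_union_iff h.1.within h.2.1 h.2.2 hM hO hα

/-! ### Channel restriction -/

/-- The action is an input or an output on the channel `c`. -/
def Action.IsOn (c : 𝒩.Channel) (α : Action 𝒩) : Prop := ∃ v, α = .out c v ∨ α = .inp c v

theorem Perform.isOn_iff {X : Set 𝒩.StateVar} {S : Set 𝒩.Sensor} {A : Set 𝒩.Actuator}
    {st st' : PhysState X S A} {l : Label 𝒩} {α : Action 𝒩} (h : Perform st l α st')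
    (c : 𝒩.Channel) : l.IsOn c ↔ α.IsOn c := by
  cases h <;> simp [Label.IsOn, Action.IsOn]

theorem map_res {X : Set 𝒩.StateVar} {S : Set 𝒩.Sensor} {A : Set 𝒩.Actuator}
    (E : PhysEnv X S A) (st : PhysState X S A) (π : Dist (ClosedProc 𝒩)) (c : 𝒩.Channel) :
    (π.map fun P => .res P c).map (CPS.mk E st) = (π.map (CPS.mk E st)).map fun M => M.res c := by
  simp [Dist.map_eq_bind, CPS.res]

theorem conf_res {X : Set 𝒩.StateVar} {S : Set 𝒩.Sensor} {A : Set 𝒩.Actuator}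
    (E : PhysEnv X S A) (σ : Dist (PhysState X S A)) (π : Dist (ClosedProc 𝒩)) (c : 𝒩.Channel) :
    conf E σ (π.map fun P => .res P c) = (conf E σ π).map fun M => M.res c := by
  simp [conf, Dist.map_eq_bind, Dist.map₂_eq_bind, CPS.res]

theorem step_res_iff {M : CPS 𝒩} {c : 𝒩.Channel} {α : Action 𝒩} {γ : Dist (CPS 𝒩)} :
    Step (M.res c) α γ ↔ ¬ α.IsOn c ∧ ∃ δ, Step M α δ ∧ γ = δ.map fun M' => M'.res c := by
  cases M with
  | dead => exact ⟨fun h => absurd h not_step_dead, fun ⟨_, _, h, _⟩ => absurd h not_step_dead⟩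
  | mk E st P =>
  rw [CPS.res]
  by_cases hinv : st.stateFun ∈ E.inv
  swap
  · constructor
    · intro h
      obtain ⟨rfl, rfl⟩ := h.eq_of_not_alive hinv
      exact ⟨by simp [Action.IsOn], _, step_dead_of_not_alive hinv (by simp),
        by simp [Dist.map_eq_bind, CPS.res]⟩
    · rintro ⟨-, δ, h, rfl⟩
      obtain ⟨rfl, rfl⟩ := h.eq_of_not_alive hinv
      rw [Dist.map_eq_bind, Dist.pure_bind]
      exact step_dead_of_not_alive hinv (by simp)
  have key {α : Action 𝒩} (hα : α ≠ .tick) {γ : Dist (CPS 𝒩)} : Step (.mk E st (.res P c)) α γ ↔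
      ¬ α.IsOn c ∧ ∃ δ, Step (.mk E st P) α δ ∧ γ = δ.map fun M' => M'.res c := by
    rw [step_mk_iff hinv hα]
    constructor
    · rintro ⟨l, st', _, hp, h, rfl⟩
      cases h with
      | @res _ _ _ π h hl =>
        exact ⟨(hp.isOn_iff c).not.1 hl, _, (step_mk_iff hinv hα).2 ⟨l, st', π, hp, h, rfl⟩,
          map_res ..⟩
    · rintro ⟨hon, _, hδ, rfl⟩
      obtain ⟨l, st', π, hp, h, rfl⟩ := (step_mk_iff hinv hα).1 hδ
      exact ⟨l, st', _, hp, .res h ((hp.isOn_iff c).not.2 hon), (map_res ..).symm⟩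
  by_cases hα : α = .tick
  swap
  · exact key hα
  subst hα
  have hs : (CPS.mk E st (.res P c)).Stable ↔ (CPS.mk E st P).Stable := by
    refine not_congr ⟨fun ⟨γ, h⟩ => ?_, fun ⟨δ, h⟩ => ⟨_, (key (by simp)).2 ⟨?_, δ, h, rfl⟩⟩⟩
    · obtain ⟨-, δ, h, -⟩ := (key (by simp)).1 h
      exact ⟨δ, h⟩
    · simp [Action.IsOn]
  constructor
  · intro h
    obtain ⟨-, hst, _, hπ, rfl⟩ := step_tick_iff.1 h
    cases hπ with
    | @res _ _ π hπ =>
      exact ⟨by simp [Action.IsOn], _, step_tick_iff.2 ⟨hinv, hs.1 hst, π, hπ, rfl⟩, conf_res ..⟩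
  · rintro ⟨-, _, hδ, rfl⟩
    obtain ⟨-, hst, π, hπ, rfl⟩ := step_tick_iff.1 hδ
    exact step_tick_iff.2 ⟨hinv, hs.2 hst, _, .res hπ, (conf_res ..).symm⟩

theorem hatStep_res {M : CPS 𝒩} {c : 𝒩.Channel} {α : Action 𝒩} (hα : ¬ α.IsOn c)
    {δ : Dist (CPS 𝒩)} (h : HatStep α M δ) :
    HatStep α (M.res c) (δ.map fun M' => M'.res c) := by
  obtain h | ⟨rfl, rfl⟩ := h
  · exact .inl (step_res_iff.2 ⟨hα, δ, h, rfl⟩)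
  · exact .inr ⟨rfl, Dist.pure_bind _ _⟩

theorem weak_res {c : 𝒩.Channel} {α : Action 𝒩} (hα : ¬ α.IsOn c) {γ γ' : Dist (CPS 𝒩)}
    (h : Weak α γ γ') : Weak α (γ.map fun M => M.res c) (γ'.map fun M => M.res c) := by
  have hτ {γ γ' : Dist (CPS 𝒩)} (h : WTau γ γ') :
      WTau (γ.map fun M => M.res c) (γ'.map fun M => M.res c) :=
    h.map (I := fun _ => True) (fun _ _ _ _ _ _ => trivial)
      (fun _ _ _ h => hatStep_res (by simp [Action.IsOn]) (.inl h)) fun _ _ => trivial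
  obtain ⟨γ₁, γ₂, h₁, h₁₂, h₂⟩ := h
  exact ⟨_, _, hτ h₁, h₁₂.bind_bind fun M _ δ hδ => Lift.of_rel (hatStep_res hα hδ), hτ h₂⟩

theorem bisimilar_res {M N : CPS 𝒩} (h : Bisimilar M N) (c : 𝒩.Channel) :
    Bisimilar (M.res c) (N.res c) := by
  obtain ⟨R, hR, hMN⟩ := h
  refine ⟨fun M' N' => ∃ M N, R M N ∧ M' = M.res c ∧ N' = N.res c,
    isWeakBisimulation_iff.2 ⟨?_, ?_⟩, M, N, hMN, rfl, rfl⟩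
  · rintro _ _ ⟨M, N, h, rfl, rfl⟩
    exact ⟨N, M, hR.1 _ _ h, rfl, rfl⟩
  · rintro _ _ ⟨M, N, h, rfl, rfl⟩ α γ hγ
    obtain ⟨hα, δ, hδ, rfl⟩ := step_res_iff.1 hγ
    obtain ⟨γ', hγ', hc⟩ := hR.exists_weak h hδ
    refine ⟨γ'.map fun N' => N'.res c, ?_, hc.map fun M' _ N' _ h' => ⟨M', N', h', rfl, rfl⟩⟩
    have := weak_res hα hγ'
    rwa [Dist.map_eq_bind, Dist.pure_bind] at this

end

end PCPS

theorem mainTheorem2 (𝒩 : PCPS.Signature.{u}) (M N : PCPS.CPS 𝒩)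
    (hM : M.WellFormed) (hN : N.WellFormed) (h : PCPS.Bisimilar M N) :
    (∀ O : PCPS.CPS 𝒩, O.WellFormed → M.PhysDisjoint O → N.PhysDisjoint O →
      PCPS.Bisimilar (M.union O) (N.union O)) ∧
    (∀ P : PCPS.ClosedProc 𝒩, P.GuardedRec → P.PureLogical →
      PCPS.Bisimilar (M.par P) (N.par P)) ∧
    (∀ c : 𝒩.Channel, PCPS.Bisimilar (M.res c) (N.res c)) := by
  refine ⟨fun O hO hMO hNO => ?_, fun P _ hP => ?_, PCPS.bisimilar_res h⟩
  · exact PCPS.isComposition_union.bisimilar ⟨hM, hO.within, hMO⟩ ⟨hN, hO.within, hNO⟩ h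
  · exact PCPS.isComposition_par.bisimilar ⟨hM, PCPS.pureLogical_iff.1 hP⟩
      ⟨hN, PCPS.pureLogical_iff.1 hP⟩ h
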